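/- Let $d\ge 1$, $l=\lfloor d/2\rfloor+1$ and $\gamma\in(-1,1]$. Let $\Phi$ belong to the Feichtinger algebra $M^1(\mathbb R^d)$, that is, $\Phi:\mathbb R^d\to\mathbb C$ is locally integrable and $$\int_{\mathbb R^d}\int_{\mathbb R^d}|V_g\Phi(z,\omega)|\,d\omega\,dz<\infty,\qquad V_g\Phi(z,\omega)=\int_{\mathbb R^d} e^{-2\pi i\,\omega\cdot t}\,\Phi(t)\,g(t-z)\,dt,$$ for some (equivalently, every) window $g\in C_c^\infty(\mathbb R^d)$ with $\|g\|_{L^2}=1$. Let $\beta:(0,\infty)\to\mathbb R$ be such that the map $\varphi(u)=\beta(|u|)u$ from $\mathbb R^d\setminus\{0\}$ to $\mathbb R^d$ is of class $C^l$ on $\mathbb R^d\setminus\{0\}$ and of class $C^{2l}$ in a neighbourhood of every point $u$ with $|u|\ge 1$, and suppose that there are constants $C_\alpha,C'_\alpha>0$ with $$|\partial^\alpha\varphi(u)|\le C_\alpha|u|^{\gamma+1-|\alpha|}\quad\text{for } 0<|u|\le 1,\ |\alpha|\le l,$$ $$|\partial^\alpha\varphi(u)|\le C'_\alpha\quad\text{for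 } |u|\ge 1,\ 2\le|\alpha|\le 2l.$$ Then for all $x,y\in\mathbb R^d$ the integral $$K(x,y)=\int_{\mathbb R^d}\Phi(u)\,e^{-2\pi i(\beta(|u|)u\cdot y-u\cdot x)}\,du$$ converges absolutely, and there is a constant $C>0$, independent of $y$, such that for every $y\in\mathbb R^d$ the function $K(\cdot,y)$ is integrable and $$\int_{\mathbb R^d}|K(x,y)|\,dx\le C(1+|y|)^{d/(\gamma+1)}.$$ -/

import Mathlib

open MeasureTheory
open scoped FourierTransform RealInnerProductSpace

namespace FIOKernel

/-- The Euclidean space `ℝᵈ`. -/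
abbrev E (d : ℕ) : Type := EuclideanSpace ℝ (Fin d)

/-- The short-time Fourier transform `V_g f (z, ω) = ∫ e^{-2πi ω·t} f(t) g(t - z) dt`, that is,
the Fourier transform of `f · T_z g` at `ω`. -/
noncomputable def stft {d : ℕ} (g f : E d → ℂ) (z ω : E d) : ℂ :=
  𝓕 (fun t : E d => f t * g (t - z)) ω

/-- The admissible windows: `g ∈ C_c^∞(ℝᵈ)` with `‖g‖_{L²} = 1`. -/
structure IsWindow {d : ℕ} (g : E d → ℂ) : Prop where
  smooth : ContDiff ℝ ((⊤ : ℕ∞) : WithTop ℕ∞) g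
  compactSupport : HasCompactSupport g
  normalized : ∫ t, ‖g t‖ ^ 2 = 1

/-- Membership in the Feichtinger algebra `M¹(ℝᵈ) = W(𝓕L¹, L¹)(ℝᵈ)`: the function `z ↦ ‖f T_z g‖_{𝓕L¹}`
is in `L¹` for a window `g`, i.e. `∫ ∫ |V_g f (z, ω)| dω dz < ∞`. (Different windows give the same
space.) Local integrability guarantees that every integral `V_g f (z, ω)` converges absolutely. -/
def MemM1 {d : ℕ} (f : E d → ℂ) : Prop :=
  LocallyIntegrable f volume ∧
    ∃ g : E d → ℂ, IsWindow g ∧ ∫⁻ z : E d, ∫⁻ ω : E d, ‖stft g f z ω‖ₑ < ⊤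

/-- The vector field `φ(u) = β(|u|) u`. For `u ≠ 0` only the values of `β` on `(0, ∞)` matter, and
`φ(0) = 0` whatever `β 0` is. -/
noncomputable def phase {d : ℕ} (β : ℝ → ℝ) (u : E d) : E d := β ‖u‖ • u

/-- The partial derivative `∂_{i₁} ⋯ ∂_{i_k} f (u)` of order `k`, where `I = (i₁, …, i_k)`.
For `f` of class `C^k` these are exactly the `∂^α f (u)` with `|α| = k`. -/
noncomputable def partialDeriv {d k : ℕ} (I : Fin k → Fin d) (f : E d → E d) (u : E d) : E d :=
  iteratedFDeriv ℝ k f u (fun j => EuclideanSpace.single (I j) (1 : ℝ))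

/-- The integrand `Φ(u) e^{-2πi(β(|u|)u·y - u·x)}` of the kernel. -/
noncomputable def integrand {d : ℕ} (Φ : E d → ℂ) (β : ℝ → ℝ) (x y u : E d) : ℂ :=
  Φ u * Complex.exp (-2 * Real.pi * Complex.I * ((⟪phase β u, y⟫ - ⟪u, x⟫ : ℝ) : ℂ))

/-- The kernel `K(x, y) = ∫ Φ(u) e^{-2πi(β(|u|)u·y - u·x)} du`. -/
noncomputable def kernel {d : ℕ} (Φ : E d → ℂ) (β : ℝ → ℝ) (x y : E d) : ℂ :=
  ∫ u : E d, integrand Φ β x y u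

end FIOKernel

/-!
Write `θ(u) = ⟪φ(u), y⟫` with `φ = phase β`, so that `K(·, y)` is the inverse Fourier transform of
`Φ e^{-2πiθ}`. Since `∫ |g(u - z)|² dz = 1` for a window `g`, the function `Φ e^{-2πiθ}` is the
superposition over `z` of the products of `Φ T_z g`, whose Fourier transform is `V_g Φ(z, ·)`, with
`conj (T_z g) e^{-2πiθ}`. The Fourier transform takes products to convolutions, hence
`‖K(·, y)‖_{L¹} ≤ ‖Φ‖_{M¹} · sup_z ‖𝓕(conj (T_z g) e^{-2πiθ})‖_{L¹}`
(`lintegral_enorm_fourierInv_mul_le_of_window`), and it remains to bound the supremum. The bound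
obtained is `C (1 + |y|)^{d/2}` (`exists_lintegral_fourier_translate_le`), which is at least as good
as `C (1 + |y|)^{d/(γ+1)}` because `γ ≤ 1`.

The tool is a Bernstein inequality (`exists_lintegral_fourier_le`): as `2l > d`, Cauchy-Schwarz
and Plancherel bound `‖𝓕 f‖_{L¹}` by `m^{d/2} (sup |f| + m^{-l} sup |r^l D^l f|)` for `f` of class
`C^l` supported in a ball of radius `r`, with a free parameter `m > 0`. For an amplitude living at
scale `r` times an oscillating factor whose phase has derivatives `|D^i θ| ≤ (M/r)^i` this gives
`M^{d/2}` (`exists_lintegral_fourier_oscillatory_le`).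

* If `z` is far from the origin, subtracting from `φ` its affine part at `z` only translates the
  Fourier transform. The remainder has all derivatives of order `1, …, l` bounded on the support of
  `T_z g`, because the derivatives of `φ` of order at least `2` are; so `M` is of size `1 + |y|`
  (`exists_lintegral_fourier_far_le`).
* If `z` is near the origin, `e^{-2πiθ} - 1` is cut dyadically into pieces living at scale
  `s = S 2^{-j}`. There `M` is of size `max(1, μ)` and `|e^{-2πiθ} - 1|` is at most of size
  `min(1, μ)`, where `μ = (1 + |y|) s^{γ+1}`. A suitable `m` gives the bound `μ^{d/2}` when `μ ≥ 1`
  and `μ^{1 - d/(2l)}` when `μ ≤ 1`. Up to constants both are at most `(1 + |y|)^{d/2}` times a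
  positive power of `2^{-j}`, so the pieces can be summed (`exists_lintegral_fourier_scale_le`,
  `exists_lintegral_fourier_near_le`).
-/

namespace FIOKernel

open Filter Topology ENNReal

/-! ### The Fourier transform of integrable functions -/

section Fourier

variable {V : Type*} [NormedAddCommGroup V] [InnerProductSpace ℝ V] [FiniteDimensional ℝ V]
  [MeasurableSpace V] [BorelSpace V]

theorem continuous_fourier {f : V → ℂ} (hf : Integrable f) : Continuous (𝓕 f) :=
  VectorFourier.fourierIntegral_continuous (L := innerₗ V) Real.continuous_fourierChar
    continuous_inner hf

theorem continuous_fourierInv {f : V → ℂ} (hf : Integrable f) : Continuous (𝓕⁻ f) := by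
  rw [Real.fourierInv_eq_fourier_comp_neg]
  exact continuous_fourier hf.comp_neg

/-- The Fourier transform is self-adjoint for the bilinear pairing `∫ f g`. -/
theorem integral_fourier_mul_eq {f g : V → ℂ} (hf : Integrable f) (hg : Integrable g) :
    ∫ ξ, 𝓕 f ξ * g ξ = ∫ x, f x * 𝓕 g x := by
  simpa using! VectorFourier.integral_fourierIntegral_smul_eq_flip (L := innerₗ V)
    Real.continuous_fourierChar continuous_inner hf hg

/-- Plancherel's theorem on `L¹ ∩ L²`, for the Fourier transform given by the integral. The latter
agrees with the extension of the Fourier transform to `L²` as both have the same integrals against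
test functions. -/
theorem eLpNorm_fourier_eq {f : V → ℂ} (hf : Integrable f) (hf2 : MemLp f 2) :
    eLpNorm (𝓕 f) 2 = eLpNorm f 2 := by
  let F : Lp (α := V) ℂ 2 := hf2.toLp f
  let F' : Lp (α := V) ℂ 2 := 𝓕 F
  have key : 𝓕 f =ᵐ[volume] F' := by
    apply ae_eq_of_integral_contDiff_smul_eq (μ := volume) (continuous_fourier hf).locallyIntegrable
      ((Lp.memLp F').locallyIntegrable (p := 2) (by norm_num))
    intro g hg hgc
    have hg' : HasCompactSupport (fun x => (g x : ℂ)) :=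
      hgc.comp_left (g := fun t : ℝ => (t : ℂ)) (by simp)
    set G : SchwartzMap V ℂ := hg'.toSchwartzMap (Complex.ofRealCLM.contDiff.comp hg) with hG
    have h1 := congrArg (fun T => T G) (Lp.fourier_toTemperedDistribution_eq F)
    simp only [TemperedDistribution.fourier_apply, Lp.toTemperedDistribution_apply] at h1
    have h2 : ∫ x, (𝓕 G) x • F x = ∫ x, (𝓕 G) x • f x := by
      apply integral_congr_ae
      filter_upwards [hf2.coeFn_toLp] with x hx
      rw [hx]
    rw [h2] at h1
    have h3 : ∀ x, G x = (g x : ℂ) := fun x => rfl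
    have h4 := integral_fourier_mul_eq (f := G) G.integrable hf
    simp only [smul_eq_mul, SchwartzMap.fourier_coe] at h1
    rw [h4] at h1
    simpa [h3] using h1
  rw [eLpNorm_congr_ae key]
  have := Lp.norm_fourier_eq F
  rw [Lp.norm_def, Lp.norm_def, ENNReal.toReal_eq_toReal_iff' (Lp.eLpNorm_ne_top _)
    (Lp.eLpNorm_ne_top _), eLpNorm_congr_ae hf2.coeFn_toLp] at this
  exact this

theorem enorm_fourier_le (f : V → ℂ) (ξ : V) : ‖𝓕 f ξ‖ₑ ≤ ∫⁻ x, ‖f x‖ₑ := by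
  rw [Real.fourier_eq]
  refine (enorm_integral_le_lintegral_enorm _).trans (le_of_eq ?_)
  simp_rw [← ofReal_norm, Circle.norm_smul]

/-- The bound `‖f‖_∞ ≤ ‖𝓕 f‖_{L¹}` for `f ∈ L¹`. Testing against smooth functions shows that `f`
agrees almost everywhere with `𝓕⁻ (𝓕 f)` once `𝓕 f` is integrable. -/
theorem ae_enorm_le_lintegral_fourier {f : V → ℂ} (hf : Integrable f) :
    ∀ᵐ u, ‖f u‖ₑ ≤ ∫⁻ ξ, ‖𝓕 f ξ‖ₑ := by
  by_cases htop : ∫⁻ ξ, ‖𝓕 f ξ‖ₑ = ⊤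
  · simp [htop]
  have hF : Integrable (𝓕 f) :=
    ⟨(continuous_fourier hf).aestronglyMeasurable, lt_top_iff_ne_top.2 htop⟩
  have key : f =ᵐ[volume] 𝓕⁻ (𝓕 f) := by
    apply ae_eq_of_integral_contDiff_smul_eq hf.locallyIntegrable
      (continuous_fourierInv hF).locallyIntegrable
    intro g hg hgc
    have hg' : HasCompactSupport (fun x => (g x : ℂ)) :=
      hgc.comp_left (g := fun t : ℝ => (t : ℂ)) (by simp)
    set G : SchwartzMap V ℂ := hg'.toSchwartzMap (Complex.ofRealCLM.contDiff.comp hg) with hG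
    have h3 : ∀ x, G x = (g x : ℂ) := fun x => rfl
    have h4 := integral_fourier_mul_eq hf (𝓕⁻ G).integrable
    rw [← SchwartzMap.fourier_coe, FourierTransform.fourier_fourierInv_eq] at h4
    have h6 := integral_fourier_mul_eq hF.comp_neg G.integrable
    rw [← Real.fourierInv_eq_fourier_comp_neg,
      ← integral_neg_eq_self (fun x => 𝓕 f (-x) * 𝓕 (⇑G) x)] at h6
    simp only [neg_neg, ← Real.fourierInv_eq_fourier_neg, ← SchwartzMap.fourierInv_coe] at h6
    rw [h4] at h6
    simp only [h3] at h6
    simp only [Complex.real_smul, mul_comm ((g _ : ℝ) : ℂ)]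
    exact h6.symm
  filter_upwards [key] with u hu
  rw [hu, Real.fourierInv_eq_fourier_comp_neg]
  refine (enorm_fourier_le _ _).trans (le_of_eq ?_)
  exact lintegral_neg_eq_self (fun x => ‖𝓕 f x‖ₑ) 

/-- Multiplication by a character translates the Fourier transform, so it preserves `‖𝓕 f‖_{L¹}`.
-/
theorem lintegral_enorm_fourier_character_mul (f : V → ℂ) (a : ℝ) (b : V) :
    ∫⁻ ξ, ‖𝓕 (fun u => 𝐞 (a + ⟪u, b⟫) • f u) ξ‖ₑ = ∫⁻ ξ, ‖𝓕 f ξ‖ₑ := by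
  have h : ∀ ξ, ‖𝓕 (fun u => 𝐞 (a + ⟪u, b⟫) • f u) ξ‖ₑ = ‖𝓕 f (ξ - b)‖ₑ := by
    intro ξ
    have : 𝓕 (fun u => 𝐞 (a + ⟪u, b⟫) • f u) ξ = 𝐞 a • 𝓕 f (ξ - b) := by
      simp only [Real.fourier_eq]
      rw [Circle.smul_def (𝐞 a), ← integral_smul]
      congr with u
      rw [← Circle.smul_def, smul_smul, smul_smul, ← AddChar.map_add_eq_mul,
        ← AddChar.map_add_eq_mul, inner_sub_right]
      congr 2
      ring
    rw [this, ← ofReal_norm, Circle.norm_smul, ofReal_norm]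
  simp_rw [h]
  exact lintegral_sub_right_eq_self (fun ξ => ‖𝓕 f ξ‖ₑ) b

/-- The product rule `‖𝓕⁻ (h m)‖_{L¹} ≤ ‖𝓕 h‖_{L¹} ‖𝓕 m‖_{L¹}`: for `m = 𝓕 w` the function `𝓕⁻ (h
m)` is `x ↦ ∫ 𝓕 h(ξ) w(ξ + x) dξ`. -/
theorem lintegral_enorm_fourierInv_mul_le {h m : V → ℂ} (hh : Integrable h) (hm : Integrable m)
    (hmc : Continuous m) :
    ∫⁻ x, ‖𝓕⁻ (fun u => h u * m u) x‖ₑ ≤ (∫⁻ ξ, ‖𝓕 h ξ‖ₑ) * ∫⁻ ξ, ‖𝓕 m ξ‖ₑ := by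
  by_cases h0 : ∫⁻ ξ, ‖𝓕 h ξ‖ₑ = 0
  · -- here `h` vanishes almost everywhere
    have hz : (fun u => h u * m u) =ᵐ[volume] fun _ => 0 := by
      filter_upwards [ae_enorm_le_lintegral_fourier hh] with u hu
      rw [h0, nonpos_iff_eq_zero, enorm_eq_zero] at hu
      simp [hu]
    have : ∀ x, 𝓕⁻ (fun u => h u * m u) x = 0 := fun x => by
      rw [Real.fourierInv_congr_ae hz, Real.fourierInv_eq]
      simp
    simp [this]
  by_cases htop : ∫⁻ ξ, ‖𝓕 m ξ‖ₑ = ⊤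
  · rw [htop, ENNReal.mul_top h0]
    exact le_top
  have hF : Integrable (𝓕 m) :=
    ⟨(continuous_fourier hm).aestronglyMeasurable, lt_top_iff_ne_top.2 htop⟩
  set w := 𝓕⁻ m with hw
  have hwc : Continuous w := continuous_fourierInv hm
  have hwn : ∀ ξ, w ξ = 𝓕 m (-ξ) := fun ξ => Real.fourierInv_eq_fourier_neg _ _
  have hwi : Integrable w := by
    have := hF.comp_neg
    simpa only [← hwn] using! this
  have hFw : 𝓕 w = m := hmc.fourier_fourierInv_eq hm hF
  have hrep : ∀ x, 𝓕⁻ (fun u => h u * m u) x = ∫ ξ, 𝓕 h ξ * w (ξ + x) := by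
    intro x
    rw [integral_fourier_mul_eq hh (hwi.comp_add_right x), Real.fourierInv_eq]
    congr with u
    have h1 := congrFun (VectorFourier.fourierIntegral_comp_add_right Real.fourierChar volume
      (innerₗ V) w x) u
    have h2 : 𝓕 (fun ξ => w (ξ + x)) u = 𝐞 ⟪x, u⟫ • 𝓕 w u := h1
    rw [h2, hFw, real_inner_comm, mul_smul_comm]
  calc ∫⁻ x, ‖𝓕⁻ (fun u => h u * m u) x‖ₑ
      ≤ ∫⁻ x, ∫⁻ ξ, ‖𝓕 h ξ‖ₑ * ‖w (ξ + x)‖ₑ := by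
        refine lintegral_mono fun x => ?_
        rw [hrep]
        refine (enorm_integral_le_lintegral_enorm _).trans (le_of_eq ?_)
        simp only [enorm_mul]
    _ = ∫⁻ ξ, ∫⁻ x, ‖𝓕 h ξ‖ₑ * ‖w (ξ + x)‖ₑ := by
        apply lintegral_lintegral_swap
        have := continuous_fourier hh
        exact Measurable.aemeasurable ((this.measurable.comp measurable_snd).enorm.mul
          (hwc.measurable.comp (measurable_snd.add measurable_fst)).enorm)
    _ = (∫⁻ ξ, ‖𝓕 h ξ‖ₑ) * ∫⁻ ξ, ‖𝓕 m ξ‖ₑ := by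
        have : ∀ ξ, ∫⁻ x, ‖𝓕 h ξ‖ₑ * ‖w (ξ + x)‖ₑ = ‖𝓕 h ξ‖ₑ * ∫⁻ ξ, ‖𝓕 m ξ‖ₑ := by
          intro ξ
          rw [lintegral_const_mul' _ _ enorm_ne_top,
            lintegral_add_left_eq_self (fun x => ‖w x‖ₑ) ξ]
          simp_rw [hwn]
          rw [lintegral_neg_eq_self (fun x => ‖𝓕 m x‖ₑ)]
        simp_rw [this]
        rw [lintegral_mul_const' _ _ htop]

end Fourier

/-! ### A Bernstein inequality for the `L¹` norm of the Fourier transform -/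

section Euclidean

variable {d : ℕ}

theorem eLpNorm_two_le_of_support_subset_closedBall {f : E d → ℂ} {c : E d} {r A : ℝ} (hr : 0 < r)
    (hf : tsupport f ⊆ Metric.closedBall c r) (hA : ∀ u, ‖f u‖ ≤ A) :
    eLpNorm f 2 ≤ ENNReal.ofReal
      (A * r ^ ((d : ℝ) / 2) * (volume.real (Metric.closedBall (0 : E d) 1)) ^ ((1 : ℝ) / 2)) := by
  have hA0 : 0 ≤ A := (norm_nonneg _).trans (hA 0)
  have h1 : eLpNorm f 2 ≤ eLpNorm ((Metric.closedBall c r).indicator fun _ => A) 2 := by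
    apply eLpNorm_mono
    intro u
    by_cases hu : u ∈ Metric.closedBall c r
    · simpa [Set.indicator_of_mem hu, abs_of_nonneg hA0] using hA u
    · rw [image_eq_zero_of_notMem_tsupport (fun h => hu (hf h))]
      simp
  refine h1.trans ?_
  rw [eLpNorm_indicator_const Metric.isClosed_closedBall.measurableSet (by norm_num) (by norm_num),
    Measure.addHaar_closedBall' _ _ hr.le, mul_assoc, ENNReal.ofReal_mul hA0,
    Real.enorm_of_nonneg hA0, ENNReal.ofReal_mul (by positivity)]
  gcongr
  rw [ENNReal.mul_rpow_of_nonneg _ _ (by positivity)]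
  gcongr
  · rw [ENNReal.ofReal_rpow_of_nonneg (by positivity) (by positivity), ← Real.rpow_natCast,
      ← Real.rpow_mul hr.le]
    simp [div_eq_mul_inv]
  · rw [← ENNReal.ofReal_rpow_of_nonneg (by positivity) (by positivity), ofReal_measureReal
      (measure_closedBall_lt_top.ne)]
    simp

/-- The weight `(1 + q|ξ|)^{-l}` is square integrable because `2l > d`; its `L²` norm scales like
`q^{-d/2}`. -/
theorem exists_eLpNorm_weight_eq {l : ℕ} (hdl : d < 2 * l) :
    ∃ κ : ℝ, 0 ≤ κ ∧ ∀ q : ℝ, 0 < q →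
      eLpNorm (fun ξ : E d => ((1 + q * ‖ξ‖) ^ l)⁻¹) 2 =
        ENNReal.ofReal (q ^ (-(d : ℝ) / 2) * κ) := by
  have hint : Integrable (fun ξ : E d => (((1 + ‖ξ‖) ^ l)⁻¹) ^ 2) := by
    have := integrable_one_add_norm (E := E d) (μ := volume) (r := ((2 * l : ℕ) : ℝ))
      (by simpa using (by exact_mod_cast hdl : ((d : ℕ) : ℝ) < ((2 * l : ℕ) : ℝ)))
    refine this.congr (ae_of_all _ fun ξ => ?_)
    simp only
    rw [Real.rpow_neg (by positivity), Real.rpow_natCast, inv_pow, ← pow_mul, mul_comm]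
  refine ⟨(∫ ξ : E d, (((1 + ‖ξ‖) ^ l)⁻¹) ^ 2) ^ ((1 : ℝ) / 2), by positivity, fun q hq => ?_⟩
  have hsc : ∀ ξ : E d, ((1 + q * ‖ξ‖) ^ l)⁻¹ = ((1 + ‖q • ξ‖) ^ l)⁻¹ := fun ξ => by
    rw [norm_smul, Real.norm_of_nonneg hq.le]
  have hint' : Integrable (fun ξ : E d => (((1 + q * ‖ξ‖) ^ l)⁻¹) ^ 2) := by
    simp_rw [hsc]
    exact hint.comp_smul hq.ne'
  have hmem : MemLp (fun ξ : E d => ((1 + q * ‖ξ‖) ^ l)⁻¹) 2 := by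
    rw [memLp_two_iff_integrable_sq]
    · exact hint'
    · apply Continuous.aestronglyMeasurable
      apply Continuous.inv₀ (by fun_prop)
      intro ξ
      positivity
  rw [hmem.eLpNorm_eq_integral_rpow_norm (by norm_num) (by norm_num)]
  congr 1
  simp only [ENNReal.toReal_ofNat, Real.rpow_ofNat, Real.norm_eq_abs, sq_abs]
  simp_rw [hsc]
  rw [Measure.integral_comp_smul (μ := volume) (fun ξ : E d => (((1 + ‖ξ‖) ^ l)⁻¹) ^ 2),
    smul_eq_mul, Real.mul_rpow (by positivity) (by positivity), abs_of_nonneg (by positivity),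
    ← Real.rpow_natCast, ← Real.rpow_neg hq.le, ← Real.rpow_mul hq.le]
  simp [div_eq_mul_inv]

theorem norm_pow_le_sum_coord_pow {l : ℕ} (hl : l ≠ 0) (ξ : E d) :
    ‖ξ‖ ^ l ≤ (d : ℝ) ^ l * ∑ i, |ξ i| ^ l := by
  obtain ⟨k, rfl⟩ := Nat.exists_eq_succ_of_ne_zero hl
  have h1 : ‖ξ‖ ≤ ∑ i, |ξ i| := by
    conv_lhs => rw [← (EuclideanSpace.basisFun (Fin d) ℝ).sum_repr ξ]
    refine (norm_sum_le _ _).trans (le_of_eq ?_)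
    simp [norm_smul]
  rcases Nat.eq_zero_or_pos d with rfl | hd
  · have : ξ = 0 := Subsingleton.elim _ _
    simp [this]
  have h3 := pow_sum_div_card_le_sum_pow (s := Finset.univ) (f := fun i => |ξ i|)
    (fun i _ => abs_nonneg _) k
  have hd' : (1 : ℝ) ≤ d := by exact_mod_cast hd
  rw [Finset.card_univ, Fintype.card_fin, div_le_iff₀ (by positivity)] at h3
  calc ‖ξ‖ ^ (k + 1) ≤ (∑ i, |ξ i|) ^ (k + 1) := by gcongr
    _ ≤ (∑ i, |ξ i| ^ (k + 1)) * (d : ℝ) ^ k := h3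
    _ ≤ (∑ i, |ξ i| ^ (k + 1)) * (d : ℝ) ^ (k + 1) := by
        gcongr ?_ * ?_
        exact pow_le_pow_right₀ hd' k.le_succ
    _ = _ := mul_comm _ _

theorem norm_fourier_pureDeriv {l : ℕ} {f : E d → ℂ} (hf : ContDiff ℝ l f)
    (hcs : HasCompactSupport f) (i : Fin d) (ξ : E d) :
    ‖𝓕 (fun u => iteratedFDeriv ℝ l f u (fun _ => EuclideanSpace.single i (1 : ℝ))) ξ‖ =
      (2 * Real.pi) ^ l * |ξ i| ^ l * ‖𝓕 f ξ‖ := by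
  have hint : ∀ n : ℕ, (n : ℕ∞) ≤ (l : ℕ∞) → Integrable (iteratedFDeriv ℝ n f) := fun n hn =>
    (hf.continuous_iteratedFDeriv (by exact_mod_cast hn)).integrable_of_hasCompactSupport
      (hcs.iteratedFDeriv n)
  have h1 := Real.fourier_iteratedFDeriv (N := l) (by exact_mod_cast hf) hint le_rfl
  have h2 := Real.fourier_continuousMultilinearMap_apply (hint l le_rfl)
    (m := fun _ => EuclideanSpace.single i (1 : ℝ)) (v := ξ)
  rw [← h2, h1, VectorFourier.fourierPowSMulRight_apply]
  have h3 : (innerSL ℝ ξ) (EuclideanSpace.single i (1 : ℝ)) = ξ i := by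
    rw [innerSL_apply_apply, EuclideanSpace.inner_single_right]
    simp
  simp [abs_of_pos Real.pi_pos, mul_assoc, h3]

theorem one_add_mul_norm_pow_le {l : ℕ} (hl : l ≠ 0) {q : ℝ} (hq : 0 < q) (ξ : E d) :
    (1 + q * ‖ξ‖) ^ l ≤ 2 ^ l * (1 + q ^ l * ((d : ℝ) ^ l * ∑ i, |ξ i| ^ l)) := by
  have h1 : (1 + q * ‖ξ‖) ^ l ≤ 2 ^ l * (1 + q ^ l * ‖ξ‖ ^ l) := by
    refine (add_pow_le zero_le_one (by positivity) l).trans ?_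
    rw [one_pow, mul_pow]
    have : (2 : ℝ) ^ (l - 1) ≤ 2 ^ l := pow_le_pow_right₀ (by norm_num) (by omega)
    gcongr
  have h2 := norm_pow_le_sum_coord_pow hl ξ
  exact h1.trans (by gcongr)

theorem eLpNorm_norm_add_mul_sum_le {F : E d → ℂ} {D : Fin d → E d → ℂ} {Q : ℝ} (hQ : 0 ≤ Q)
    (hFm : AEStronglyMeasurable F volume) (hDm : ∀ i, AEStronglyMeasurable (D i) volume) :
    eLpNorm (fun ξ => ‖F ξ‖ + Q * ∑ i, ‖D i ξ‖) 2 ≤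
      eLpNorm F 2 + ENNReal.ofReal Q * ∑ i, eLpNorm (D i) 2 := by
  have hs : AEStronglyMeasurable (fun ξ => ∑ i, ‖D i ξ‖) volume :=
    Finset.aestronglyMeasurable_fun_sum _ fun i _ => (hDm i).norm
  have h1 : eLpNorm (fun ξ => ‖F ξ‖ + Q * ∑ i, ‖D i ξ‖) 2 ≤ eLpNorm (fun ξ => ‖F ξ‖) 2 +
      eLpNorm (fun ξ => Q * ∑ i, ‖D i ξ‖) 2 :=
    eLpNorm_add_le hFm.norm (hs.const_mul _) (by norm_num)
  refine h1.trans ?_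
  rw [eLpNorm_norm]
  refine add_le_add le_rfl ?_
  have h2 := eLpNorm_const_smul Q (fun ξ => ∑ i, ‖D i ξ‖) 2 volume
  have h3 : Q • (fun ξ => ∑ i, ‖D i ξ‖) = fun ξ => Q * ∑ i, ‖D i ξ‖ := rfl
  rw [h3] at h2
  rw [h2, Real.enorm_of_nonneg hQ]
  refine mul_le_mul_right ?_ _
  have h4 : (fun ξ => ∑ i, ‖D i ξ‖) = ∑ i, fun ξ => ‖D i ξ‖ := by
    ext ξ
    simp
  rw [h4]
  refine (eLpNorm_sum_le (fun i _ => (hDm i).norm) (by norm_num)).trans ?_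
  refine Finset.sum_le_sum fun i _ => ?_
  rw [eLpNorm_norm]

/-- The Cauchy-Schwarz step of the Bernstein inequality: `D i` plays the role of the Fourier
transform of the `l`-th derivative in the direction of the `i`-th coordinate. -/
theorem exists_lintegral_enorm_le_of_coord_pow_mul_le {l : ℕ} (hdl : d < 2 * l) :
    ∃ κ : ℝ, 0 ≤ κ ∧ ∀ (F : E d → ℂ) (D : Fin d → E d → ℂ) (q : ℝ), 0 < q →
      AEStronglyMeasurable F volume → (∀ i, AEStronglyMeasurable (D i) volume) →
      (∀ i ξ, |ξ i| ^ l * ‖F ξ‖ ≤ ‖D i ξ‖) →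
      ∫⁻ ξ, ‖F ξ‖ₑ ≤ ENNReal.ofReal (q ^ (-(d : ℝ) / 2) * κ) *
        (eLpNorm F 2 + ENNReal.ofReal (q ^ l) * ∑ i, eLpNorm (D i) 2) := by
  obtain ⟨κ, hκ, hw⟩ := exists_eLpNorm_weight_eq hdl
  refine ⟨κ * (2 ^ l * (1 + (d : ℝ) ^ l)), by positivity, fun F D q hq hFm hDm hFD => ?_⟩
  have hl : l ≠ 0 := by omega
  obtain ⟨K, hK⟩ : ∃ K : ℝ, K = 2 ^ l * (1 + (d : ℝ) ^ l) := ⟨_, rfl⟩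
  rw [← hK]
  have hK0 : 0 ≤ K := by rw [hK]; positivity
  have hpt : ∀ ξ, ‖F ξ‖ ≤ K * ‖((1 + q * ‖ξ‖) ^ l)⁻¹ • (‖F ξ‖ + q ^ l * ∑ i, ‖D i ξ‖)‖ := by
    intro ξ
    have h5 : 0 ≤ q ^ l * ∑ i, ‖D i ξ‖ := by positivity
    rw [norm_smul, Real.norm_of_nonneg (by positivity),
      Real.norm_of_nonneg (add_nonneg (norm_nonneg _) h5),
      inv_mul_eq_div, mul_div_assoc', le_div_iff₀ (by positivity)]
    calc ‖F ξ‖ * (1 + q * ‖ξ‖) ^ l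
        ≤ ‖F ξ‖ * (2 ^ l * (1 + q ^ l * ((d : ℝ) ^ l * ∑ i, |ξ i| ^ l))) :=
          mul_le_mul_of_nonneg_left (one_add_mul_norm_pow_le hl hq ξ) (norm_nonneg _)
      _ = 2 ^ l * (‖F ξ‖ + (d : ℝ) ^ l * (q ^ l * ∑ i, |ξ i| ^ l * ‖F ξ‖)) := by
          rw [← Finset.sum_mul]
          ring
      _ ≤ 2 ^ l * (‖F ξ‖ + (d : ℝ) ^ l * (q ^ l * ∑ i, ‖D i ξ‖)) := by
          gcongr with i
          exact hFD i ξ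
      _ ≤ K * (‖F ξ‖ + q ^ l * ∑ i, ‖D i ξ‖) := by
          rw [hK, mul_assoc]
          refine mul_le_mul_of_nonneg_left ?_ (by positivity)
          have h6 : 0 ≤ (d : ℝ) ^ l * ‖F ξ‖ := by positivity
          linarith
  have hwm : AEStronglyMeasurable (fun ξ : E d => ((1 + q * ‖ξ‖) ^ l)⁻¹) volume := by
    apply Continuous.aestronglyMeasurable
    apply Continuous.inv₀ (by fun_prop)
    intro ξ
    positivity
  have hGm : AEStronglyMeasurable (fun ξ => ‖F ξ‖ + q ^ l * ∑ i, ‖D i ξ‖) volume :=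
    hFm.norm.add (AEStronglyMeasurable.const_mul
      (Finset.aestronglyMeasurable_fun_sum _ fun i _ => (hDm i).norm) _)
  have hCS := eLpNorm_smul_le_mul_eLpNorm (p := 2) (q := 2) (r := 1) hGm hwm
  have h1 : eLpNorm F 1 ≤ ENNReal.ofReal K * eLpNorm ((fun ξ : E d => ((1 + q * ‖ξ‖) ^ l)⁻¹) •
      fun ξ => ‖F ξ‖ + q ^ l * ∑ i, ‖D i ξ‖) 1 :=
    eLpNorm_le_mul_eLpNorm_of_ae_le_mul (ae_of_all _ hpt) 1
  rw [hw q hq] at hCS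
  have h2 := eLpNorm_norm_add_mul_sum_le (Q := q ^ l) (by positivity) hFm hDm
  have h3 := h1.trans (mul_le_mul_right (hCS.trans (mul_le_mul_right h2 _)) _)
  rw [← mul_assoc, ← ENNReal.ofReal_mul hK0, eLpNorm_one_eq_lintegral_enorm] at h3
  rwa [show q ^ (-(d : ℝ) / 2) * (κ * K) = K * (q ^ (-(d : ℝ) / 2) * κ) by ring]

theorem exists_lintegral_fourier_le_mul_eLpNorm {l : ℕ} (hdl : d < 2 * l) :
    ∃ κ : ℝ, 0 ≤ κ ∧ ∀ (f : E d → ℂ) (q : ℝ), 0 < q → ContDiff ℝ l f → HasCompactSupport f →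
      ∫⁻ ξ, ‖𝓕 f ξ‖ₑ ≤ ENNReal.ofReal (q ^ (-(d : ℝ) / 2) * κ) * (eLpNorm f 2 +
        ENNReal.ofReal (q ^ l) * ∑ i : Fin d, eLpNorm
          (fun u => iteratedFDeriv ℝ l f u (fun _ => EuclideanSpace.single i (1 : ℝ))) 2) := by
  obtain ⟨κ, hκ, H⟩ := exists_lintegral_enorm_le_of_coord_pow_mul_le hdl
  refine ⟨κ, hκ, fun f q hq hf hcs => ?_⟩
  have hDc : ∀ i : Fin d, Continuous
      (fun u => iteratedFDeriv ℝ l f u (fun _ => EuclideanSpace.single i (1 : ℝ))) := fun i => by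
    have := hf.continuous_iteratedFDeriv (m := l) le_rfl
    fun_prop
  have hDcs : ∀ i : Fin d, HasCompactSupport
      (fun u => iteratedFDeriv ℝ l f u (fun _ => EuclideanSpace.single i (1 : ℝ))) := fun i =>
    (hcs.iteratedFDeriv (𝕜 := ℝ) l).comp_left
      (g := fun T : ContinuousMultilinearMap ℝ (fun _ : Fin l => E d) ℂ =>
        T (fun _ => EuclideanSpace.single i (1 : ℝ))) rfl
  have hfi : Integrable f := hf.continuous.integrable_of_hasCompactSupport hcs
  have hDi := fun i => (hDc i).integrable_of_hasCompactSupport (μ := volume) (hDcs i)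
  refine (H (𝓕 f) (fun i => 𝓕 (fun u => iteratedFDeriv ℝ l f u
    (fun _ => EuclideanSpace.single i (1 : ℝ)))) q hq (continuous_fourier hfi).aestronglyMeasurable
    (fun i => (continuous_fourier (hDi i)).aestronglyMeasurable) ?_).trans (le_of_eq ?_)
  · intro i ξ
    rw [norm_fourier_pureDeriv hf hcs, mul_assoc]
    refine le_mul_of_one_le_left (by positivity) (one_le_pow₀ ?_)
    linarith [Real.pi_gt_three]
  · rw [eLpNorm_fourier_eq hfi (hf.continuous.memLp_of_hasCompactSupport hcs)]
    congr 3
    refine Finset.sum_congr rfl fun i _ => ?_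
    rw [eLpNorm_fourier_eq (hDi i) ((hDc i).memLp_of_hasCompactSupport (hDcs i))]

/-- Bernstein inequality for a function of class `C^l` supported in a ball of radius `r`. The
parameter `m` is free: it is the frequency, in units of `1 / r`, at which the two terms are
balanced. -/
theorem exists_lintegral_fourier_le {l : ℕ} (hdl : d < 2 * l) :
    ∃ C : ℝ, 0 < C ∧ ∀ (f : E d → ℂ) (c : E d) (r A B m : ℝ), 0 < r → 0 < m →
      ContDiff ℝ l f → tsupport f ⊆ Metric.closedBall c r → (∀ u, ‖f u‖ ≤ A) →
      (∀ u, r ^ l * ‖iteratedFDeriv ℝ l f u‖ ≤ B) →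
      ∫⁻ ξ, ‖𝓕 f ξ‖ₑ ≤ ENNReal.ofReal (C * m ^ ((d : ℝ) / 2) * (A + B / m ^ l)) := by
  obtain ⟨κ, hκ, hw⟩ := exists_lintegral_fourier_le_mul_eLpNorm hdl
  set v : ℝ := (volume.real (Metric.closedBall (0 : E d) 1)) ^ ((1 : ℝ) / 2) with hv
  have hv0 : 0 ≤ v := by positivity
  refine ⟨κ * v * (1 + d) + 1, by positivity, ?_⟩
  intro f c r A B m hr hm hf hsupp hA hB
  have hA0 : 0 ≤ A := (norm_nonneg _).trans (hA 0)
  have hB0 : 0 ≤ B := le_trans (by positivity) (hB 0)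
  have hcs : HasCompactSupport f :=
    (isCompact_closedBall c r).of_isClosed_subset (isClosed_tsupport f) hsupp
  have hDL2 : ∀ i : Fin d, eLpNorm
      (fun u => iteratedFDeriv ℝ l f u (fun _ => EuclideanSpace.single i (1 : ℝ))) 2 ≤
        ENNReal.ofReal (B / r ^ l * r ^ ((d : ℝ) / 2) * v) := by
    intro i
    apply eLpNorm_two_le_of_support_subset_closedBall hr (c := c)
    · refine (closure_minimal ?_ (isClosed_tsupport f)).trans hsupp
      intro u hu
      apply support_iteratedFDeriv_subset (𝕜 := ℝ) l
      intro h0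
      apply hu
      simp [h0]
    · intro u
      rw [le_div_iff₀' (by positivity)]
      refine le_trans ?_ (hB u)
      gcongr
      refine (ContinuousMultilinearMap.le_opNorm _ _).trans (le_of_eq ?_)
      simp
  have hq0 : 0 < r / m := by positivity
  refine (hw f (r / m) hq0 hf hcs).trans ?_
  have hsum : eLpNorm f 2 + ENNReal.ofReal ((r / m) ^ l) * ∑ i : Fin d, eLpNorm
      (fun u => iteratedFDeriv ℝ l f u (fun _ => EuclideanSpace.single i (1 : ℝ))) 2 ≤
      ENNReal.ofReal (r ^ ((d : ℝ) / 2) * v * ((1 + d) * (A + B / m ^ l))) := by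
    calc _ ≤ ENNReal.ofReal (A * r ^ ((d : ℝ) / 2) * v) + ENNReal.ofReal ((r / m) ^ l) *
          ∑ i : Fin d, ENNReal.ofReal (B / r ^ l * r ^ ((d : ℝ) / 2) * v) := by
          gcongr with i
          · exact eLpNorm_two_le_of_support_subset_closedBall hr hsupp hA
          · exact hDL2 i
      _ = ENNReal.ofReal (r ^ ((d : ℝ) / 2) * v * (A + d * (B / m ^ l))) := by
          rw [Finset.sum_const, Finset.card_univ, Fintype.card_fin, nsmul_eq_mul,
            ← ENNReal.ofReal_natCast, ← ENNReal.ofReal_mul (by positivity),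
            ← ENNReal.ofReal_mul (by positivity), ← ENNReal.ofReal_add (by positivity)
            (by positivity), div_pow]
          congr 1
          field_simp
      _ ≤ _ := by
          apply ENNReal.ofReal_le_ofReal
          have h1 : 0 ≤ B / m ^ l := by positivity
          have h2 : 0 ≤ (d : ℝ) * A := by positivity
          gcongr
          linarith
  refine (mul_le_mul_right hsum _).trans ?_
  rw [← ENNReal.ofReal_mul (by positivity)]
  apply ENNReal.ofReal_le_ofReal
  have h1 : (r / m) ^ (-(d : ℝ) / 2) * r ^ ((d : ℝ) / 2) = m ^ ((d : ℝ) / 2) := by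
    rw [neg_div, Real.rpow_neg (by positivity), Real.div_rpow hr.le hm.le]
    have : r ^ ((d : ℝ) / 2) ≠ 0 := by positivity
    field_simp
  calc (r / m) ^ (-(d : ℝ) / 2) * κ * (r ^ ((d : ℝ) / 2) * v * ((1 + d) * (A + B / m ^ l)))
      = ((r / m) ^ (-(d : ℝ) / 2) * r ^ ((d : ℝ) / 2)) * κ * v * ((1 + d) * (A + B / m ^ l)) := by
        ring
    _ = (κ * v * (1 + d)) * m ^ ((d : ℝ) / 2) * (A + B / m ^ l) := by
        rw [h1]
        ring
    _ ≤ _ := by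
        gcongr
        linarith

/-! ### Amplitudes times oscillating factors -/

theorem iteratedDeriv_const_mul_cexp (b c : ℂ) (k : ℕ) :
    iteratedDeriv k (fun t : ℝ => b * Complex.exp (c * t)) =
      fun t : ℝ => b * c ^ k * Complex.exp (c * t) := by
  induction k generalizing b with
  | zero => simp
  | succ k ih =>
    have h : deriv (fun t : ℝ => b * Complex.exp (c * t)) =
        fun t : ℝ => (b * c) * Complex.exp (c * t) := by
      ext t
      have h1 : HasDerivAt (fun t : ℝ => c * (t : ℂ)) (c * 1) t :=
        (Complex.ofRealCLM.hasDerivAt (x := t)).const_mul c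
      rw [(h1.cexp.const_mul b).deriv]
      ring
    rw [iteratedDeriv_succ', h, ih]
    ext t
    ring

theorem contDiff_fourierChar_neg_sub (κ : ℂ) {n : WithTop ℕ∞} :
    ContDiff ℝ n (fun t : ℝ => (𝐞 (-t) : ℂ) - κ) := by
  simp only [Real.fourierChar_apply]
  have : ContDiff ℝ n (fun t : ℝ => ((2 * Real.pi * (-t) : ℝ) : ℂ)) :=
    Complex.ofRealCLM.contDiff.comp (contDiff_const.mul contDiff_neg)
  exact ((this.mul contDiff_const).cexp).sub contDiff_const

/-- The derivatives of `t ↦ e^{-2πit} - κ`, uniformly for orders `k ≤ l`. -/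
theorem norm_iteratedFDeriv_fourierChar_neg_sub_le {κ : ℂ} (hκ : ‖κ‖ ≤ 1) {k l : ℕ} (hk : k ≤ l)
    (t : ℝ) :
    ‖iteratedFDeriv ℝ k (fun t : ℝ => (𝐞 (-t) : ℂ) - κ) t‖ ≤ 2 * (2 * Real.pi) ^ l := by
  have hpi : (1 : ℝ) ≤ 2 * Real.pi := by linarith [Real.pi_gt_three]
  have hpl : (1 : ℝ) ≤ (2 * Real.pi) ^ l := one_le_pow₀ hpi
  rw [norm_iteratedFDeriv_eq_norm_iteratedDeriv]
  rcases k with _ | k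
  · rw [iteratedDeriv_zero]
    refine (norm_sub_le _ _).trans ?_
    rw [Circle.norm_coe]
    linarith
  · set c : ℂ := -(2 * Real.pi * Complex.I) with hc
    have hexp : ∀ t : ℝ, (𝐞 (-t) : ℂ) = 1 * Complex.exp (c * t) := fun t => by
      rw [Real.fourierChar_apply, one_mul, hc]
      push_cast
      ring_nf
    have h1 : deriv (fun t : ℝ => (𝐞 (-t) : ℂ) - κ) =
        deriv (fun t : ℝ => 1 * Complex.exp (c * t)) := by
      ext t
      simp_rw [hexp]
      rw [deriv_sub_const]
    rw [iteratedDeriv_succ', h1, ← iteratedDeriv_succ', iteratedDeriv_const_mul_cexp]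
    simp only
    rw [mul_assoc, one_mul, ← one_mul (Complex.exp _), ← hexp, norm_mul,
      Circle.norm_coe, norm_pow, hc, norm_neg]
    simp only [norm_mul, Complex.norm_I, Complex.norm_real, Real.norm_of_nonneg Real.pi_pos.le,
      Complex.norm_ofNat, mul_one]
    calc (2 * Real.pi) ^ (k + 1) ≤ (2 * Real.pi) ^ l := pow_le_pow_right₀ hpi hk
      _ ≤ _ := by linarith

theorem norm_iteratedFDeriv_oscillation_le {θ : E d → ℝ} {U : Set (E d)} {κ : ℂ} {r M : ℝ}
    {k l : ℕ} (hr : 0 < r) (hM : 1 ≤ M) (hU : IsOpen U) (hθ : ContDiffOn ℝ l θ U) (hκ : ‖κ‖ ≤ 1)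
    (hk : k ≤ l) {u : E d} (hu : u ∈ U)
    (hder : ∀ i, 1 ≤ i → i ≤ l → ‖iteratedFDeriv ℝ i θ u‖ ≤ (M / r) ^ i) :
    ‖iteratedFDerivWithin ℝ k (fun u => (𝐞 (-θ u) : ℂ) - κ) U u‖ ≤
      l.factorial * (2 * (2 * Real.pi) ^ l) * M ^ l * (r ^ k)⁻¹ := by
  have h := norm_iteratedFDerivWithin_comp_le (g := fun t : ℝ => (𝐞 (-t) : ℂ) - κ) (f := θ)
    (s := U) (t := Set.univ) (n := k) (N := (l : WithTop ℕ∞)) (x := u) (C := 2 * (2 * Real.pi) ^ l)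
    (D := M / r)
    (contDiff_fourierChar_neg_sub κ).contDiffOn hθ (by exact_mod_cast hk) uniqueDiffOn_univ
    hU.uniqueDiffOn (Set.mapsTo_univ _ _) hu
    (fun i hi => by
      rw [iteratedFDerivWithin_univ]
      exact norm_iteratedFDeriv_fourierChar_neg_sub_le hκ (hi.trans hk) _)
    (fun i hi hi' => by
      rw [iteratedFDerivWithin_of_isOpen i hU hu]
      exact hder i hi (hi'.trans hk))
  refine h.trans ?_
  rw [div_pow, div_eq_mul_inv, ← mul_assoc]
  gcongr

/-- The Fourier transform of an amplitude `P` at scale `r` times `e^{-2πiθ} - κ`. The values `κ =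
0` and `κ = 1` are used; for `κ = 1` the factor may be small, which `a` records. The phase `θ`
only needs to be smooth on an open set `U` containing the support of `P`. -/
theorem exists_lintegral_fourier_oscillatory_le {l : ℕ} (hdl : d < 2 * l) :
    ∃ C : ℝ, 0 < C ∧ ∀ (P : E d → ℂ) (θ : E d → ℝ) (U : Set (E d)) (κ : ℂ) (c : E d)
      (r A a M m : ℝ), 0 < r → 0 ≤ A → 0 ≤ a → 1 ≤ M → 0 < m → IsOpen U → ContDiff ℝ l P →
      tsupport P ⊆ U → tsupport P ⊆ Metric.closedBall c r → ContDiffOn ℝ l θ U → ‖κ‖ ≤ 1 →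
      (∀ k ≤ l, ∀ u, ‖iteratedFDeriv ℝ k P u‖ ≤ A * (r ^ k)⁻¹) →
      (∀ u ∈ tsupport P, ∀ i, 1 ≤ i → i ≤ l → ‖iteratedFDeriv ℝ i θ u‖ ≤ (M / r) ^ i) →
      (∀ u ∈ tsupport P, ‖(𝐞 (-θ u) : ℂ) - κ‖ ≤ a) →
      ∫⁻ ξ, ‖𝓕 (fun u => P u * ((𝐞 (-θ u) : ℂ) - κ)) ξ‖ₑ ≤
        ENNReal.ofReal (C * A * m ^ ((d : ℝ) / 2) * (a + M ^ l / m ^ l)) := by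
  obtain ⟨C, hC, H⟩ := exists_lintegral_fourier_le hdl
  obtain ⟨B, hB, hB0⟩ : ∃ B : ℝ, B = l.factorial * (2 * (2 * Real.pi) ^ l) ∧ 0 ≤ B :=
    ⟨_, rfl, by positivity⟩
  refine ⟨C * (1 + 2 ^ l * B), by positivity, ?_⟩
  intro P θ U κ c r A a M m hr hA ha hM hm hU hP hPU hPc hθ hκ hPder hθder hsmall
  have hts : tsupport (fun u => P u * ((𝐞 (-θ u) : ℂ) - κ)) ⊆ tsupport P := tsupport_mul_subset_left
  have hQ : ContDiffOn ℝ l (fun u => (𝐞 (-θ u) : ℂ) - κ) U :=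
    (contDiff_fourierChar_neg_sub κ).comp_contDiffOn hθ
  have hsm : ContDiff ℝ l (fun u => P u * ((𝐞 (-θ u) : ℂ) - κ)) := by
    rw [contDiff_iff_contDiffAt]
    intro u
    by_cases hu : u ∈ tsupport P
    · exact hP.contDiffAt.mul (hQ.contDiffAt (hU.mem_nhds (hPU hu)))
    · have : (fun u => P u * ((𝐞 (-θ u) : ℂ) - κ)) =ᶠ[𝓝 u] fun _ => 0 := by
        filter_upwards [notMem_tsupport_iff_eventuallyEq.1 hu] with v hv
        rw [hv]
        simp
      exact contDiffAt_const.congr_of_eventuallyEq this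
  refine (H _ c r (A * a) (2 ^ l * B * A * M ^ l) m hr hm hsm (hts.trans hPc) ?_ ?_).trans ?_
  · intro u
    by_cases hu : u ∈ tsupport P
    · rw [norm_mul]
      have := hPder 0 (Nat.zero_le _) u
      rw [norm_iteratedFDeriv_zero, pow_zero, inv_one, mul_one] at this
      exact mul_le_mul this (hsmall u hu) (norm_nonneg _) hA
    · rw [image_eq_zero_of_notMem_tsupport hu]
      simp
      positivity
  · intro u
    by_cases hu : u ∈ tsupport P
    · rw [← iteratedFDerivWithin_of_isOpen l hU (hPU hu), ← le_div_iff₀' (by positivity)]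
      refine (norm_iteratedFDerivWithin_mul_le (N := (l : WithTop ℕ∞)) hP.contDiffOn hQ
        hU.uniqueDiffOn (hPU hu) le_rfl).trans ?_
      calc _ ≤ ∑ i ∈ Finset.range (l + 1), (l.choose i : ℝ) * (A * (r ^ i)⁻¹) *
            (B * M ^ l * (r ^ (l - i))⁻¹) := by
            refine Finset.sum_le_sum fun i hi => ?_
            have hi' : i ≤ l := Nat.lt_succ_iff.1 (Finset.mem_range.1 hi)
            have h1 := hPder i hi' u
            rw [← iteratedFDerivWithin_of_isOpen i hU (hPU hu)] at h1
            have h2 := norm_iteratedFDeriv_oscillation_le hr hM hU hθ hκ (Nat.sub_le l i) (hPU hu)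
              (hθder u hu)
            rw [← hB] at h2
            gcongr
        _ = ∑ i ∈ Finset.range (l + 1), (l.choose i : ℝ) * (B * A * M ^ l / r ^ l) := by
            refine Finset.sum_congr rfl fun i hi => ?_
            have hi' : i ≤ l := Nat.lt_succ_iff.1 (Finset.mem_range.1 hi)
            have : r ^ l = r ^ i * r ^ (l - i) := by rw [← pow_add, Nat.add_sub_cancel' hi']
            rw [this]
            field_simp
        _ = _ := by
            rw [← Finset.sum_mul, ← Nat.cast_sum, Nat.sum_range_choose]
            push_cast
            ring
    · have : u ∉ Function.support
          (iteratedFDeriv ℝ l (fun u => P u * ((𝐞 (-θ u) : ℂ) - κ))) := fun h =>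
        hu (hts (support_iteratedFDeriv_subset l h))
      rw [Function.notMem_support.1 this]
      simp
      positivity
  · apply ENNReal.ofReal_le_ofReal
    have h1 : 0 ≤ M ^ l / m ^ l := by positivity
    calc C * m ^ ((d : ℝ) / 2) * (A * a + 2 ^ l * B * A * M ^ l / m ^ l)
        = C * m ^ ((d : ℝ) / 2) * A * (a + 2 ^ l * B * (M ^ l / m ^ l)) := by ring
      _ ≤ C * m ^ ((d : ℝ) / 2) * A * ((1 + 2 ^ l * B) * (a + M ^ l / m ^ l)) := by
          gcongr
          have : 0 ≤ 2 ^ l * B * a := by positivity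
          nlinarith
      _ = _ := by ring

/-! ### One dyadic scale near the origin -/

theorem norm_fourierChar_neg_sub_one_le (t : ℝ) : ‖(𝐞 (-t) : ℂ) - 1‖ ≤ 2 * Real.pi * |t| := by
  have h := Real.norm_exp_I_mul_ofReal_sub_one_le (x := 2 * Real.pi * -t)
  rw [Real.fourierChar_apply, mul_comm _ Complex.I]
  refine h.trans (le_of_eq ?_)
  rw [Real.norm_eq_abs, abs_mul, abs_neg, abs_of_pos (by positivity)]

theorem norm_iteratedFDeriv_comp_smul_le {l k : ℕ} {η : E d → ℂ} (hη : ContDiff ℝ l η) (hk : k ≤ l)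
    {t : ℝ} (ht : 0 < t) (u : E d) :
    ‖iteratedFDeriv ℝ k (fun u => η (t⁻¹ • u)) u‖ ≤
      ‖iteratedFDeriv ℝ k η (t⁻¹ • u)‖ * (t ^ k)⁻¹ := by
  have h := (t⁻¹ • ContinuousLinearMap.id ℝ (E d)).iteratedFDeriv_comp_right hη u
    (i := k) (by exact_mod_cast hk)
  have h' : iteratedFDeriv ℝ k (fun u => η (t⁻¹ • u)) u =
      (iteratedFDeriv ℝ k η (t⁻¹ • u)).compContinuousLinearMap
        fun _ => t⁻¹ • ContinuousLinearMap.id ℝ (E d) := h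
  rw [h']
  refine (ContinuousMultilinearMap.norm_compContinuousLinearMap_le _ _).trans ?_
  gcongr
  rw [Finset.prod_const, Finset.card_univ, Fintype.card_fin, ← inv_pow]
  gcongr
  rw [norm_smul, norm_inv, Real.norm_of_nonneg ht.le]
  exact mul_le_of_le_one_right (by positivity) ContinuousLinearMap.norm_id_le

theorem mul_rpow_le_of_le_one {X T e D : ℝ} (hX : 1 ≤ X) (hT : 0 < T) (hT1 : T ≤ 1)
    (he : e ≤ D) : (X * T) ^ D ≤ X ^ D * T ^ e ∧ (X * T) ^ e ≤ X ^ D * T ^ e := by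
  have hX0 : 0 ≤ X := by linarith
  rw [Real.mul_rpow hX0 hT.le, Real.mul_rpow hX0 hT.le]
  constructor
  · gcongr ?_ * ?_
    exact Real.rpow_le_rpow_of_exponent_ge hT hT1 he
  · gcongr

/-- For `d = 1` this relies on `l` being `1`; for `d ≥ 2` it holds for every `l`. -/
theorem one_sub_div_le_half {l : ℕ} (hd : 0 < d) (hl : l = d / 2 + 1) :
    1 - (d : ℝ) / (2 * l) ≤ (d : ℝ) / 2 := by
  have hl0 : (0 : ℝ) < l := by
    have : 0 < l := by omega
    exact_mod_cast this
  rw [sub_le_iff_le_add, ← sub_le_iff_le_add', le_div_iff₀ (by positivity)]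
  have h2 : 2 * l ≤ d * l + d := by
    rcases Nat.lt_or_ge d 2 with h | h
    · have : d = 1 := by omega
      subst this
      omega
    · nlinarith
  have h2' : (2 : ℝ) * l ≤ d * l + d := by exact_mod_cast h2
  nlinarith

/-- The piece of `G (e^{-2πi⟪φ, y⟫} - 1)` at distance about `S t` from the origin, where `σ = γ +
1` is the homogeneity of `φ` at the origin. The factor `(t ^ σ) ^ (1 - d / (2 l))` makes the
dyadic sum over `t = 2^{-j}` converge. -/
theorem exists_lintegral_fourier_scale_le {l : ℕ} (hd : 0 < d) (hl : l = d / 2 + 1) {φ : E d → E d}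
    {σ C₁ S : ℝ} (hσ : 0 < σ) (hC₁ : 1 ≤ C₁) (hS : 1 ≤ S) (hφ : ContDiffOn ℝ l φ {0}ᶜ)
    (hb : ∀ k ≤ l, ∀ u : E d, u ≠ 0 → ‖u‖ ≤ S →
      ‖iteratedFDeriv ℝ k φ u‖ ≤ C₁ * ‖u‖ ^ (σ - k))
    {η : E d → ℂ} (hη : ContDiff ℝ l η)
    (hηs : ∀ u ∈ tsupport η, S / 4 ≤ ‖u‖ ∧ ‖u‖ ≤ S) :
    ∃ C : ℝ, 0 < C ∧ ∀ (G : E d → ℂ) (A : ℝ) (y : E d) (t : ℝ), ContDiff ℝ l G → 0 ≤ A →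
      (∀ k ≤ l, ∀ u, ‖iteratedFDeriv ℝ k G u‖ ≤ A) → 0 < t → t ≤ 1 →
      ∫⁻ ξ, ‖𝓕 (fun u => (G u * η (t⁻¹ • u)) * ((𝐞 (-⟪φ u, y⟫) : ℂ) - 1)) ξ‖ₑ ≤
        ENNReal.ofReal (C * A * (1 + ‖y‖) ^ ((d : ℝ) / 2) * (t ^ σ) ^ (1 - (d : ℝ) / (2 * l))) := by
  have hdl : d < 2 * l := by omega
  have hl0 : (0 : ℝ) < l := by
    have : 0 < l := by omega
    exact_mod_cast this
  obtain ⟨C₀, hC₀, H⟩ := exists_lintegral_fourier_oscillatory_le (d := d) hdl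
  have hηc : HasCompactSupport η := by
    refine (isCompact_closedBall (0 : E d) S).of_isClosed_subset (isClosed_tsupport η) ?_
    intro u hu
    simpa using (hηs u hu).2
  obtain ⟨Cη, hCη0, hCη⟩ : ∃ Cη : ℝ, 0 ≤ Cη ∧ ∀ k ≤ l, ∀ u, ‖iteratedFDeriv ℝ k η u‖ ≤ Cη := by
    have h1 : ∀ k : ℕ, ∃ c : ℝ, 0 ≤ c ∧ (k ≤ l → ∀ u, ‖iteratedFDeriv ℝ k η u‖ ≤ c) := by
      intro k
      by_cases hk : k ≤ l
      · obtain ⟨c, hc⟩ := (hηc.iteratedFDeriv (𝕜 := ℝ) k).exists_bound_of_continuous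
          (hη.continuous_iteratedFDeriv (by exact_mod_cast hk))
        exact ⟨c, (norm_nonneg _).trans (hc 0), fun _ => hc⟩
      · exact ⟨0, le_rfl, fun h => absurd h hk⟩
    choose c hc0 hc using h1
    refine ⟨∑ k ∈ Finset.range (l + 1), c k, Finset.sum_nonneg fun k _ => hc0 k, fun k hk u => ?_⟩
    refine (hc k hk u).trans ?_
    exact Finset.single_le_sum (f := c) (fun i _ => hc0 i) (Finset.mem_range.2 (by omega))
  have hS0 : 0 < S := by linarith
  refine ⟨C₀ * (2 ^ l * Cη * S ^ l) * (2 + 2 * Real.pi * C₁ + (4 * C₁) ^ l) *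
    (S ^ σ) ^ ((d : ℝ) / 2) + 1, by positivity, ?_⟩
  intro G A y t hG hA hGA ht ht1
  set s : ℝ := S * t with hs
  have hs0 : 0 < s := by positivity
  set μ : ℝ := (1 + ‖y‖) * s ^ σ with hμ
  have hμ0 : 0 < μ := by positivity
  have hηt : ContDiff ℝ l (fun u : E d => η (t⁻¹ • u)) := hη.comp (contDiff_const_smul _)
  have hP : ContDiff ℝ l (fun u => G u * η (t⁻¹ • u)) := hG.mul hηt
  -- the support of the cutoff at scale `t`
  have hsupp : ∀ u ∈ tsupport (fun u => G u * η (t⁻¹ • u)), s / 4 ≤ ‖u‖ ∧ ‖u‖ ≤ s := by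
    intro u hu
    have h1 : u ∈ tsupport (fun u : E d => η (t⁻¹ • u)) := tsupport_mul_subset_right hu
    have h2 : t⁻¹ • u ∈ tsupport η :=
      tsupport_comp_subset_preimage η (f := fun u : E d => t⁻¹ • u) (continuous_const_smul _) h1
    have h3 := hηs _ h2
    rw [norm_smul, norm_inv, Real.norm_of_nonneg ht.le, inv_mul_eq_div, le_div_iff₀ ht,
      div_le_iff₀ ht] at h3
    exact ⟨by linarith [h3.1], h3.2⟩
  have hne : ∀ u ∈ tsupport (fun u => G u * η (t⁻¹ • u)), u ≠ 0 := by
    intro u hu h0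
    have := (hsupp u hu).1
    rw [h0, norm_zero] at this
    linarith
  have hsS : s ≤ S := by rw [hs]; exact mul_le_of_le_one_right hS0.le ht1
  have hder : ∀ u ∈ tsupport (fun u => G u * η (t⁻¹ • u)), ∀ i ≤ l,
      ‖iteratedFDeriv ℝ i (fun u => ⟪φ u, y⟫) u‖ ≤ C₁ * μ * (4 / s) ^ i := by
    intro u hu i hi
    have hu0 := norm_pos_iff.2 (hne u hu)
    have h1 : ‖iteratedFDeriv ℝ i (fun u => ⟪φ u, y⟫) u‖ ≤ ‖y‖ * ‖iteratedFDeriv ℝ i φ u‖ := by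
      have h2 := (innerSL ℝ y).norm_iteratedFDeriv_comp_left (f := φ) (x := u) (n := i)
        (N := (l : WithTop ℕ∞)) (hφ.contDiffAt (isOpen_compl_singleton.mem_nhds (hne u hu)))
        (by exact_mod_cast hi)
      rw [innerSL_apply_norm] at h2
      have h3 : (fun u => ⟪φ u, y⟫) = (innerSL ℝ y) ∘ φ := by
        ext u
        simp [real_inner_comm]
      rwa [h3]
    have h4 := hb i hi u (hne u hu) ((hsupp u hu).2.trans hsS)
    rw [Real.rpow_sub hu0, Real.rpow_natCast] at h4
    calc _ ≤ ‖y‖ * ‖iteratedFDeriv ℝ i φ u‖ := h1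
      _ ≤ (1 + ‖y‖) * (C₁ * (s ^ σ / (s / 4) ^ i)) := by
        gcongr
        · linarith
        · refine h4.trans ?_
          gcongr
          · exact (hsupp u hu).2
          · exact (hsupp u hu).1
      _ = C₁ * μ * (4 / s) ^ i := by
        rw [hμ, div_pow, div_pow]
        field_simp
  have hPder : ∀ k ≤ l, ∀ u, ‖iteratedFDeriv ℝ k (fun u => G u * η (t⁻¹ • u)) u‖ ≤
      (2 ^ l * Cη * S ^ l * A) * (s ^ k)⁻¹ := by
    intro k hk u
    refine (norm_iteratedFDeriv_mul_le (N := (l : WithTop ℕ∞)) hG hηt u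
      (by exact_mod_cast hk)).trans ?_
    calc _ ≤ ∑ i ∈ Finset.range (k + 1), (k.choose i : ℝ) * (A * (Cη * (t ^ k)⁻¹)) := by
          refine Finset.sum_le_sum fun i hi => ?_
          rw [mul_assoc]
          gcongr
          · exact hGA i ((Nat.lt_succ_iff.1 (Finset.mem_range.1 hi)).trans hk) u
          · refine (norm_iteratedFDeriv_comp_smul_le hη ((Nat.sub_le _ _).trans hk) ht u).trans ?_
            have h1 : t ^ k ≤ t ^ (k - i) := pow_le_pow_of_le_one ht.le ht1 (Nat.sub_le _ _)
            gcongr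
            exact hCη _ ((Nat.sub_le _ _).trans hk) _
      _ = 2 ^ k * (A * (Cη * (S ^ k * (s ^ k)⁻¹))) := by
          rw [← Finset.sum_mul, ← Nat.cast_sum, Nat.sum_range_choose, hs, mul_pow]
          push_cast
          field_simp
      _ ≤ 2 ^ l * (A * (Cη * (S ^ l * (s ^ k)⁻¹))) := by
          gcongr
          norm_num
      _ = _ := by ring
  have hsupp' : tsupport (fun u => G u * η (t⁻¹ • u)) ⊆ Metric.closedBall 0 s := fun u hu => by
    simpa using (hsupp u hu).2
  have hθ : ContDiffOn ℝ l (fun u => ⟪φ u, y⟫) {0}ᶜ := hφ.inner ℝ contDiffOn_const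
  have hsmall : ∀ u ∈ tsupport (fun u => G u * η (t⁻¹ • u)),
      ‖(𝐞 (-⟪φ u, y⟫) : ℂ) - 1‖ ≤ 2 * Real.pi * C₁ * μ := by
    intro u hu
    refine (norm_fourierChar_neg_sub_one_le _).trans ?_
    have := hder u hu 0 (Nat.zero_le _)
    rw [norm_iteratedFDeriv_zero, pow_zero, mul_one, Real.norm_eq_abs] at this
    rw [mul_assoc _ C₁]
    exact mul_le_mul_of_nonneg_left this (by positivity)
  -- for `μ ≥ 1` the oscillation dominates and `m = μ` balances the two terms; for `μ ≤ 1` the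
  -- smallness `a ≲ μ` is available and the balance is at `m = μ ^ (-1 / l)`
  have key : ∫⁻ ξ, ‖𝓕 (fun u => (G u * η (t⁻¹ • u)) * ((𝐞 (-⟪φ u, y⟫) : ℂ) - 1)) ξ‖ₑ ≤
      ENNReal.ofReal (C₀ * (2 ^ l * Cη * S ^ l * A) *
        ((2 + 2 * Real.pi * C₁ + (4 * C₁) ^ l) *
          max (μ ^ ((d : ℝ) / 2)) (μ ^ (1 - (d : ℝ) / (2 * l))))) := by
    rcases le_total 1 μ with hμ1 | hμ1
    · refine (H _ _ _ 1 0 s (2 ^ l * Cη * S ^ l * A) 2 (4 * C₁ * μ) μ hs0 (by positivity)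
        zero_le_two (by nlinarith) hμ0 isOpen_compl_singleton hP (fun u hu => hne u hu) hsupp' hθ
        (by simp) hPder ?_ ?_).trans ?_
      · intro u hu i hi hil
        refine (hder u hu i hil).trans ?_
        have h1 : C₁ * μ ≤ (C₁ * μ) ^ i := le_self_pow₀ (by nlinarith) (by omega)
        calc C₁ * μ * (4 / s) ^ i ≤ (C₁ * μ) ^ i * (4 / s) ^ i := by gcongr
          _ = _ := by rw [← mul_pow]; ring
      · intro u _
        refine (norm_sub_le _ _).trans ?_
        rw [Circle.norm_coe, norm_one]
        norm_num
      · apply ENNReal.ofReal_le_ofReal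
        rw [mul_assoc]
        refine mul_le_mul_of_nonneg_left ?_ (by positivity)
        rw [mul_pow _ μ, mul_div_assoc, div_self (by positivity), mul_one, mul_comm]
        gcongr
        · have : 0 ≤ 2 * Real.pi * C₁ := by positivity
          linarith
        · exact le_max_left _ _
    · have hm : (μ ^ (-(1 : ℝ) / l)) ^ l = μ⁻¹ := by
        rw [← Real.rpow_natCast, ← Real.rpow_mul hμ0.le, div_mul_cancel₀ _ hl0.ne',
          Real.rpow_neg_one]
      refine (H _ _ _ 1 0 s (2 ^ l * Cη * S ^ l * A) (2 * Real.pi * C₁ * μ) (4 * C₁)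
        (μ ^ (-(1 : ℝ) / l)) hs0 (by positivity)
        (by positivity) (by linarith) (by positivity) isOpen_compl_singleton hP
        (fun u hu => hne u hu) hsupp' hθ (by simp) hPder ?_ hsmall).trans ?_
      · intro u hu i hi hil
        refine (hder u hu i hil).trans ?_
        have h1 : C₁ ≤ C₁ ^ i := le_self_pow₀ hC₁ (by omega)
        calc C₁ * μ * (4 / s) ^ i ≤ C₁ ^ i * 1 * (4 / s) ^ i := by gcongr
          _ = _ := by rw [mul_one, ← mul_pow]; ring
      · apply ENNReal.ofReal_le_ofReal
        rw [mul_assoc]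
        refine mul_le_mul_of_nonneg_left ?_ (by positivity)
        rw [hm, div_inv_eq_mul, ← add_mul, mul_left_comm]
        have h1 : (μ ^ (-(1 : ℝ) / l)) ^ ((d : ℝ) / 2) * μ = μ ^ (1 - (d : ℝ) / (2 * l)) := by
          rw [← Real.rpow_mul hμ0.le]
          nth_rewrite 2 [← Real.rpow_one μ]
          rw [← Real.rpow_add hμ0]
          congr 1
          field_simp
          ring
        rw [h1]
        gcongr
        · linarith
        · exact le_max_right _ _
  refine key.trans (ENNReal.ofReal_le_ofReal ?_)
  have hX : 1 ≤ (1 + ‖y‖) * S ^ σ := by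
    have h1 : 1 ≤ S ^ σ := Real.one_le_rpow hS hσ.le
    nlinarith [norm_nonneg y]
  have hμX : μ = ((1 + ‖y‖) * S ^ σ) * t ^ σ := by
    rw [hμ, hs, Real.mul_rpow hS0.le ht.le, mul_assoc]
  have hmax := mul_rpow_le_of_le_one hX (T := t ^ σ) (by positivity)
    (Real.rpow_le_one ht.le ht1 hσ.le) (one_sub_div_le_half hd hl)
  rw [← hμX] at hmax
  calc _ ≤ C₀ * (2 ^ l * Cη * S ^ l * A) * ((2 + 2 * Real.pi * C₁ + (4 * C₁) ^ l) *
        (((1 + ‖y‖) * S ^ σ) ^ ((d : ℝ) / 2) * (t ^ σ) ^ (1 - (d : ℝ) / (2 * l)))) := by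
        gcongr
        exact max_le hmax.1 hmax.2
    _ = (C₀ * (2 ^ l * Cη * S ^ l) * (2 + 2 * Real.pi * C₁ + (4 * C₁) ^ l) *
          (S ^ σ) ^ ((d : ℝ) / 2)) * A * (1 + ‖y‖) ^ ((d : ℝ) / 2) *
          (t ^ σ) ^ (1 - (d : ℝ) / (2 * l)) := by
        rw [Real.mul_rpow (by positivity) (by positivity)]
        ring
    _ ≤ _ := by
        gcongr
        linarith

/-! ### Summation over the dyadic scales -/

theorem fourier_sum_apply {ι : Type*} (s : Finset ι) {f : ι → E d → ℂ}
    (hf : ∀ i ∈ s, Integrable (f i)) (ξ : E d) :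
    𝓕 (fun u => ∑ i ∈ s, f i u) ξ = ∑ i ∈ s, 𝓕 (f i) ξ := by
  simp only [Real.fourier_eq]
  rw [← integral_finsetSum _ fun i hi => (Real.fourierIntegral_convergent_iff ξ).2 (hf i hi)]
  congr with u
  rw [Finset.smul_sum]

theorem lintegral_enorm_fourier_add_sum_le {f : E d → ℂ} {g : ℕ → E d → ℂ} (hf : Integrable f)
    (hg : ∀ j, Integrable (g j)) (n : ℕ) :
    ∫⁻ ξ, ‖𝓕 (fun u => f u + ∑ j ∈ Finset.range n, g j u) ξ‖ₑ ≤
      (∫⁻ ξ, ‖𝓕 f ξ‖ₑ) + ∑ j ∈ Finset.range n, ∫⁻ ξ, ‖𝓕 (g j) ξ‖ₑ := by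
  have h1 : ∀ ξ, 𝓕 (fun u => f u + ∑ j ∈ Finset.range n, g j u) ξ =
      𝓕 f ξ + ∑ j ∈ Finset.range n, 𝓕 (g j) ξ := fun ξ => by
    rw [← fourier_sum_apply _ (fun j _ => hg j)]
    simp only [Real.fourier_eq]
    rw [← integral_add ((Real.fourierIntegral_convergent_iff ξ).2 hf)
      ((Real.fourierIntegral_convergent_iff ξ).2 (integrable_finsetSum _ fun j _ => hg j))]
    congr with u
    rw [smul_add]
  calc _ ≤ ∫⁻ ξ, (‖𝓕 f ξ‖ₑ + ∑ j ∈ Finset.range n, ‖𝓕 (g j) ξ‖ₑ) := by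
        refine lintegral_mono fun ξ => ?_
        rw [h1]
        exact (enorm_add_le _ _).trans (add_le_add le_rfl (enorm_sum_le _ _))
    _ = _ := by
        rw [lintegral_add_left (continuous_fourier hf).enorm.measurable,
          lintegral_finsetSum _ fun j _ => (continuous_fourier (hg j)).enorm.measurable]

/-- Fatou's lemma on the Fourier side: bounds on `‖𝓕 f‖_{L¹}` pass to dominated pointwise limits.
-/
theorem lintegral_enorm_fourier_le_of_tendsto {F : ℕ → E d → ℂ} {f : E d → ℂ} {b : E d → ℝ}
    (hF : ∀ n, Integrable (F n)) (hb : Integrable b) (hFb : ∀ n u, ‖F n u‖ ≤ b u)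
    (hlim : ∀ u, Tendsto (fun n => F n u) atTop (𝓝 (f u))) {B : ℝ≥0∞}
    (hB : ∀ n, ∫⁻ ξ, ‖𝓕 (F n) ξ‖ₑ ≤ B) : ∫⁻ ξ, ‖𝓕 f ξ‖ₑ ≤ B := by
  have h1 : ∀ ξ, Tendsto (fun n => 𝓕 (F n) ξ) atTop (𝓝 (𝓕 f ξ)) := by
    intro ξ
    simp only [Real.fourier_eq]
    refine tendsto_integral_of_dominated_convergence b
      (fun n => ((Real.fourierIntegral_convergent_iff ξ).2 (hF n)).aestronglyMeasurable) hb
      (fun n => ae_of_all _ fun u => ?_) (ae_of_all _ fun u => (hlim u).const_smul _)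
    rw [Circle.norm_smul]
    exact hFb n u
  calc ∫⁻ ξ, ‖𝓕 f ξ‖ₑ = ∫⁻ ξ, liminf (fun n => ‖𝓕 (F n) ξ‖ₑ) atTop := by
        congr with ξ
        exact ((h1 ξ).enorm.liminf_eq).symm
    _ ≤ liminf (fun n => ∫⁻ ξ, ‖𝓕 (F n) ξ‖ₑ) atTop :=
        lintegral_liminf_le fun n => (continuous_fourier (hF n)).enorm.measurable
    _ ≤ B := by
        refine liminf_le_of_le ?_ fun b hb => ?_
        · isBoundedDefault
        · obtain ⟨n, hn⟩ := hb.exists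
          exact hn.trans (hB n)

/-- Windows supported near the origin. The sum of the dyadic pieces telescopes to `G (1 - ρ(2^n
·)) (e^{-2πi⟪φ, y⟫} - 1)`, with `ρ` a cutoff equal to `1` on the support of `G`. -/
theorem exists_lintegral_fourier_near_le {l : ℕ} (hd : 0 < d) (hl : l = d / 2 + 1) {φ : E d → E d}
    {σ C₁ S : ℝ} (hσ : 0 < σ) (hC₁ : 1 ≤ C₁) (hS : 1 ≤ S) (hφ0 : φ 0 = 0) (hφc : Continuous φ)
    (hφ : ContDiffOn ℝ l φ {0}ᶜ)
    (hb : ∀ k ≤ l, ∀ u : E d, u ≠ 0 → ‖u‖ ≤ S →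
      ‖iteratedFDeriv ℝ k φ u‖ ≤ C₁ * ‖u‖ ^ (σ - k)) :
    ∃ C : ℝ, 0 < C ∧ ∀ (G : E d → ℂ) (A : ℝ) (y : E d), ContDiff ℝ l G →
      (∀ k ≤ l, ∀ u, ‖iteratedFDeriv ℝ k G u‖ ≤ A) → tsupport G ⊆ Metric.closedBall 0 (S / 2) →
      ∫⁻ ξ, ‖𝓕 (fun u => G u * (𝐞 (-⟪φ u, y⟫) : ℂ)) ξ‖ₑ ≤
        ENNReal.ofReal (C * A * (1 + ‖y‖) ^ ((d : ℝ) / 2)) := by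
  have hdl : d < 2 * l := by omega
  have hl0 : (0 : ℝ) < l := by
    have : 0 < l := by omega
    exact_mod_cast this
  have hS0 : 0 < S := by linarith
  let ρ : ContDiffBump (0 : E d) := ⟨S / 2, S, by positivity, by linarith⟩
  have hρ1 : ∀ u : E d, ‖u‖ ≤ S / 2 → ρ u = 1 := fun u hu =>
    ρ.one_of_mem_closedBall (by simpa using hu)
  have hρ0 : ∀ u : E d, S ≤ ‖u‖ → ρ u = 0 := fun u hu => ρ.zero_of_le_dist (by simpa using hu)
  set η : E d → ℂ := fun u => ((ρ u - ρ ((2 : ℝ) • u) : ℝ) : ℂ) with hη_def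
  have hη : ContDiff ℝ l η :=
    Complex.ofRealCLM.contDiff.comp (ρ.contDiff.sub (ρ.contDiff.comp (contDiff_const_smul _)))
  have hηs : ∀ u ∈ tsupport η, S / 4 ≤ ‖u‖ ∧ ‖u‖ ≤ S := by
    have hcl : IsClosed {u : E d | S / 4 ≤ ‖u‖ ∧ ‖u‖ ≤ S} :=
      (isClosed_le continuous_const continuous_norm).inter
        (isClosed_le continuous_norm continuous_const)
    refine fun u hu => closure_minimal (t := {u : E d | S / 4 ≤ ‖u‖ ∧ ‖u‖ ≤ S}) ?_ hcl hu
    intro v hv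
    have h2v : ‖(2 : ℝ) • v‖ = 2 * ‖v‖ := by rw [norm_smul]; simp
    by_contra hcon
    apply hv
    simp only [Set.mem_ofPred_eq, not_and_or, not_le] at hcon
    rw [hη_def]
    rcases hcon with h | h
    · simp only
      rw [hρ1 v (by linarith), hρ1 _ (by rw [h2v]; linarith)]
      simp
    · simp only
      rw [hρ0 v h.le, hρ0 _ (by rw [h2v]; linarith)]
      simp
  obtain ⟨C₀, hC₀, H⟩ := exists_lintegral_fourier_scale_le hd hl hσ hC₁ hS hφ hb hη hηs
  obtain ⟨C₂, hC₂, H₂⟩ := exists_lintegral_fourier_le (d := d) hdl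
  set e : ℝ := 1 - (d : ℝ) / (2 * l) with he
  have he0 : 0 < e := by
    rw [he, sub_pos, div_lt_one (by positivity)]
    exact_mod_cast hdl
  set q : ℝ := ((2 : ℝ)⁻¹ ^ σ) ^ e with hq
  have hq0 : 0 ≤ q := by positivity
  have hq1 : q < 1 :=
    Real.rpow_lt_one (by positivity) (Real.rpow_lt_one (by norm_num) (by norm_num) hσ) he0
  have h1q : 0 < 1 - q := by linarith
  refine ⟨C₂ * (1 + S ^ l) + C₀ * (1 - q)⁻¹, by positivity, ?_⟩
  intro G A y hG hGA hGs
  have hA : 0 ≤ A := (norm_nonneg _).trans (hGA 0 (Nat.zero_le _) 0)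
  have hGc : HasCompactSupport G :=
    (isCompact_closedBall (0 : E d) (S / 2)).of_isClosed_subset (isClosed_tsupport G) hGs
  have hGi : Integrable G := hG.continuous.integrable_of_hasCompactSupport hGc
  have hec : Continuous (fun u => (𝐞 (-⟪φ u, y⟫) : ℂ)) := by fun_prop
  set g : ℕ → E d → ℂ := fun j u =>
    (G u * η (((2 : ℝ)⁻¹ ^ j)⁻¹ • u)) * ((𝐞 (-⟪φ u, y⟫) : ℂ) - 1) with hg
  have hgi : ∀ j, Integrable (g j) := by
    intro j
    have hc : Continuous (g j) :=
      (hG.continuous.mul (hη.continuous.comp (continuous_const_smul _))).mul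
        (hec.sub continuous_const)
    exact hc.integrable_of_hasCompactSupport (hGc.mul_right.mul_right)
  have hgF : ∀ j, ∫⁻ ξ, ‖𝓕 (g j) ξ‖ₑ ≤
      ENNReal.ofReal (C₀ * A * (1 + ‖y‖) ^ ((d : ℝ) / 2) * q ^ j) := by
    intro j
    have hpow : (((2 : ℝ)⁻¹ ^ j) ^ σ) ^ e = q ^ j := by
      have h2 : (0 : ℝ) ≤ 2⁻¹ := by norm_num
      rw [hq, ← Real.rpow_natCast, ← Real.rpow_natCast, ← Real.rpow_mul h2, ← Real.rpow_mul h2,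
        ← Real.rpow_mul h2, ← Real.rpow_mul h2]
      congr 1
      ring
    rw [← hpow]
    exact H G A y _ hG hA hGA (by positivity) (pow_le_one₀ (by norm_num) (by norm_num))
  have htel : ∀ (n : ℕ) (u : E d), G u + ∑ j ∈ Finset.range n, g j u =
      G u * (1 + ((1 - ρ ((2 : ℝ) ^ n • u) : ℝ) : ℂ) * ((𝐞 (-⟪φ u, y⟫) : ℂ) - 1)) := by
    intro n u
    by_cases hu : u ∈ tsupport G
    · have hsum : ∑ j ∈ Finset.range n, η (((2 : ℝ)⁻¹ ^ j)⁻¹ • u) =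
          ((1 - ρ ((2 : ℝ) ^ n • u) : ℝ) : ℂ) := by
        have h1 : ρ ((2 : ℝ) ^ 0 • u) = 1 := by
          rw [pow_zero, one_smul]
          exact hρ1 u (by simpa using hGs hu)
        rw [← h1, ← Finset.sum_range_sub' (fun j => ρ ((2 : ℝ) ^ j • u)), Complex.ofReal_sum]
        refine Finset.sum_congr rfl fun j _ => ?_
        rw [hη_def]
        simp only [smul_smul, inv_pow, inv_inv, pow_succ']
      rw [hg]
      simp only
      rw [← Finset.sum_mul, ← Finset.mul_sum, hsum]
      ring
    · rw [hg]
      simp [image_eq_zero_of_notMem_tsupport hu]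
  refine lintegral_enorm_fourier_le_of_tendsto
    (F := fun n u => G u + ∑ j ∈ Finset.range n, g j u) (b := fun u => 3 * ‖G u‖)
    (fun n => hGi.add (integrable_finsetSum _ fun j _ => hgi j)) (hGi.norm.const_mul 3) ?_ ?_ ?_
  · intro n u
    rw [htel, norm_mul, mul_comm]
    gcongr
    refine (norm_add_le _ _).trans ?_
    rw [norm_one, norm_mul, Complex.norm_real, 
      Real.norm_of_nonneg (by linarith [ρ.le_one (x := (2 : ℝ) ^ n • u)])]
    have h1 : ‖(𝐞 (-⟪φ u, y⟫) : ℂ) - 1‖ ≤ 2 := by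
      refine (norm_sub_le _ _).trans ?_
      rw [Circle.norm_coe, norm_one]
      norm_num
    have h2 : 1 - ρ ((2 : ℝ) ^ n • u) ≤ 1 := by linarith [ρ.nonneg' ((2 : ℝ) ^ n • u)]
    have h3 : 0 ≤ 1 - ρ ((2 : ℝ) ^ n • u) := by linarith [ρ.le_one (x := (2 : ℝ) ^ n • u)]
    nlinarith [norm_nonneg ((𝐞 (-⟪φ u, y⟫) : ℂ) - 1)]
  · intro u
    by_cases hu : u = 0
    · subst hu
      refine tendsto_const_nhds.congr fun n => ?_
      rw [htel]
      simp [hφ0]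
    · have hu0 : 0 < ‖u‖ := norm_pos_iff.2 hu
      have hev : ∀ᶠ n : ℕ in atTop, S ≤ (2 : ℝ) ^ n * ‖u‖ := by
        have := (tendsto_pow_atTop_atTop_of_one_lt (one_lt_two (α := ℝ))).atTop_mul_const hu0
        exact this.eventually_ge_atTop S
      refine tendsto_const_nhds.congr' ?_
      filter_upwards [hev] with n hn
      rw [htel, hρ0 _ (by rw [norm_smul]; simpa using hn)]
      simp
  · intro n
    refine (lintegral_enorm_fourier_add_sum_le hGi hgi n).trans ?_
    have hΛ : 1 ≤ (1 + ‖y‖) ^ ((d : ℝ) / 2) :=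
      Real.one_le_rpow (by linarith [norm_nonneg y]) (by positivity)
    have h1 : ∫⁻ ξ, ‖𝓕 G ξ‖ₑ ≤ ENNReal.ofReal (C₂ * (1 + S ^ l) * A *
        (1 + ‖y‖) ^ ((d : ℝ) / 2)) := by
      refine (H₂ G 0 S A (S ^ l * A) 1 hS0 one_pos hG
        (hGs.trans (Metric.closedBall_subset_closedBall (by linarith))) (fun u => ?_)
        (fun u => ?_)).trans (ENNReal.ofReal_le_ofReal ?_)
      · simpa using hGA 0 (Nat.zero_le _) u
      · exact mul_le_mul_of_nonneg_left (hGA l le_rfl u) (by positivity)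
      · rw [Real.one_rpow, one_pow, div_one, mul_one]
        calc C₂ * (A + S ^ l * A) = C₂ * (1 + S ^ l) * A * 1 := by ring
          _ ≤ _ := by gcongr
    have h2 : ∑ j ∈ Finset.range n, q ^ j ≤ (1 - q)⁻¹ := by
      rw [← tsum_geometric_of_lt_one hq0 hq1]
      exact (summable_geometric_of_lt_one hq0 hq1).sum_le_tsum _ (fun j _ => by positivity)
    calc _ ≤ ENNReal.ofReal (C₂ * (1 + S ^ l) * A * (1 + ‖y‖) ^ ((d : ℝ) / 2)) +
          ∑ j ∈ Finset.range n,
            ENNReal.ofReal (C₀ * A * (1 + ‖y‖) ^ ((d : ℝ) / 2) * q ^ j) :=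
          add_le_add h1 (Finset.sum_le_sum fun j _ => hgF j)
      _ = ENNReal.ofReal (C₂ * (1 + S ^ l) * A * (1 + ‖y‖) ^ ((d : ℝ) / 2) +
            C₀ * A * (1 + ‖y‖) ^ ((d : ℝ) / 2) * ∑ j ∈ Finset.range n, q ^ j) := by
          rw [← ENNReal.ofReal_sum_of_nonneg fun j _ => by positivity, ← Finset.mul_sum,
            ENNReal.ofReal_add (by positivity) (by positivity)]
      _ ≤ ENNReal.ofReal (C₂ * (1 + S ^ l) * A * (1 + ‖y‖) ^ ((d : ℝ) / 2) +
            C₀ * A * (1 + ‖y‖) ^ ((d : ℝ) / 2) * (1 - q)⁻¹) := by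
          gcongr
      _ = ENNReal.ofReal ((C₂ * (1 + S ^ l) + C₀ * (1 - q)⁻¹) * A *
            (1 + ‖y‖) ^ ((d : ℝ) / 2)) := by
          congr 1
          ring

/-! ### Windows away from the origin -/

/-- Removing the affine part of `φ` at the centre `z` of a ball bounds the first derivative as
well, by the mean value inequality for `fderiv ℝ φ`. -/
theorem norm_iteratedFDeriv_sub_affine_le {n : ℕ} (hn : 2 ≤ n) {φ : E d → E d} {z : E d} {R C₁ : ℝ}
    (hR : 1 ≤ R) (hC₁ : 0 ≤ C₁) (hφ : ∀ u ∈ Metric.closedBall z R, ContDiffAt ℝ n φ u)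
    (hb : ∀ k, 2 ≤ k → k ≤ n → ∀ u ∈ Metric.closedBall z R, ‖iteratedFDeriv ℝ k φ u‖ ≤ C₁)
    {u : E d} (hu : u ∈ Metric.closedBall z R) {i : ℕ} (hi : 1 ≤ i) (hin : i ≤ n) :
    ‖iteratedFDeriv ℝ i (fun u => φ u - (φ z + fderiv ℝ φ z (u - z))) u‖ ≤ C₁ * R := by
  have h1n : (1 : WithTop ℕ∞) ≤ (n : WithTop ℕ∞) := by exact_mod_cast (by omega : 1 ≤ n)
  have h2n : (1 : WithTop ℕ∞) + 1 ≤ (n : WithTop ℕ∞) := by exact_mod_cast hn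
  have hev : fderiv ℝ (fun u => φ u - (φ z + fderiv ℝ φ z (u - z))) =ᶠ[𝓝 u]
      fun u => fderiv ℝ φ u - fderiv ℝ φ z := by
    filter_upwards [((hφ u hu).of_le h1n).eventually (by simp)] with v hv
    have h1 : HasFDerivAt φ (fderiv ℝ φ v) v := (hv.differentiableAt one_ne_zero).hasFDerivAt
    have h2 : HasFDerivAt (fun u => φ z + fderiv ℝ φ z (u - z)) (fderiv ℝ φ z) v := by
      have := ((fderiv ℝ φ z).hasFDerivAt (x := v - z)).comp v ((hasFDerivAt_id v).sub_const z)
      simpa using this.const_add (φ z)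
    exact (h1.sub h2).fderiv
  obtain ⟨k, rfl⟩ : ∃ k, i = k + 1 := ⟨i - 1, by omega⟩
  rw [← norm_iteratedFDeriv_fderiv, (hev.iteratedFDeriv ℝ k).eq_of_nhds]
  rcases k with _ | k
  · rw [norm_iteratedFDeriv_zero]
    have hd2 : ∀ v ∈ Metric.closedBall z R, ‖fderiv ℝ (fderiv ℝ φ) v‖ ≤ C₁ := fun v hv => by
      have h1 := norm_iteratedFDeriv_fderiv (𝕜 := ℝ) (f := fderiv ℝ φ) (x := v) (n := 0)
      rw [norm_iteratedFDeriv_zero, norm_iteratedFDeriv_fderiv] at h1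
      rw [h1]
      exact hb 2 le_rfl hn v hv
    have hdiff : ∀ v ∈ Metric.closedBall z R, DifferentiableAt ℝ (fderiv ℝ φ) v := fun v hv =>
      (((hφ v hv).fderiv_right (m := 1) h2n).differentiableAt one_ne_zero)
    have h3 := (convex_closedBall z R).norm_image_sub_le_of_norm_fderiv_le hdiff hd2
      (Metric.mem_closedBall_self (by linarith)) hu
    refine h3.trans ?_
    gcongr
    simpa [dist_eq_norm] using hu
  · rw [← norm_iteratedFDeriv_fderiv]
    have h4 : fderiv ℝ (fun u => fderiv ℝ φ u - fderiv ℝ φ z) = fderiv ℝ (fderiv ℝ φ) := by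
      ext1 v
      rw [fderiv_sub_const]
    rw [h4, norm_iteratedFDeriv_fderiv, norm_iteratedFDeriv_fderiv]
    refine (hb _ (by omega) hin u hu).trans ?_
    nlinarith

/-- Windows supported in `{|u| > 1}`, where only the derivatives of `φ` of order at least `2` are
bounded. -/
theorem exists_lintegral_fourier_far_le {l n : ℕ} (hdl : d < 2 * l) (hn : 2 ≤ n) (hln : l ≤ n)
    {φ : E d → E d} {R C₁ : ℝ} (hR : 1 ≤ R) (hC₁ : 1 ≤ C₁)
    (hφ : ∀ u : E d, 1 ≤ ‖u‖ → ContDiffAt ℝ n φ u)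
    (hb : ∀ k, 2 ≤ k → k ≤ n → ∀ u : E d, 1 ≤ ‖u‖ → ‖iteratedFDeriv ℝ k φ u‖ ≤ C₁) :
    ∃ C : ℝ, 0 < C ∧ ∀ (G : E d → ℂ) (A : ℝ) (z y : E d), R + 1 < ‖z‖ → ContDiff ℝ l G →
      (∀ k ≤ l, ∀ u, ‖iteratedFDeriv ℝ k G u‖ ≤ A) → tsupport G ⊆ Metric.closedBall z R →
      ∫⁻ ξ, ‖𝓕 (fun u => G u * (𝐞 (-⟪φ u, y⟫) : ℂ)) ξ‖ₑ ≤
        ENNReal.ofReal (C * A * (1 + ‖y‖) ^ ((d : ℝ) / 2)) := by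
  obtain ⟨C₀, hC₀, H⟩ := exists_lintegral_fourier_oscillatory_le (d := d) hdl
  have hR0 : 0 < R := by linarith
  refine ⟨C₀ * R ^ l * (C₁ * R ^ 2) ^ ((d : ℝ) / 2) * 2, by positivity, ?_⟩
  intro G A z y hz hG hGA hGs
  have hA : 0 ≤ A := (norm_nonneg _).trans (hGA 0 (Nat.zero_le _) 0)
  have hball : ∀ u ∈ Metric.closedBall z R, 1 < ‖u‖ := by
    intro u hu
    have h1 : ‖u - z‖ ≤ R := by simpa [dist_eq_norm] using hu
    have h2 := norm_sub_norm_le z u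
    rw [norm_sub_rev] at h2
    linarith
  have hUo : IsOpen {u : E d | 1 < ‖u‖} := isOpen_lt continuous_const continuous_norm
  set L := fderiv ℝ φ z with hL
  set ψ : E d → E d := fun u => φ u - (φ z + L (u - z)) with hψ
  have hψs : ∀ u : E d, 1 < ‖u‖ → ContDiffAt ℝ l ψ u := fun u hu =>
    ((hφ u hu.le).of_le (by exact_mod_cast hln)).sub (by fun_prop)
  set b : E d := -(ContinuousLinearMap.adjoint L y) with hbdef
  set a : ℝ := ⟪L z - φ z, y⟫ with hadef
  -- the affine part of `φ` at `z` contributes a character in `u`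
  have hfac : (fun u => G u * (𝐞 (-⟪φ u, y⟫) : ℂ)) =
      fun u => 𝐞 (a + ⟪u, b⟫) • (G u * ((𝐞 (-⟪ψ u, y⟫) : ℂ) - 0)) := by
    ext u
    have hinner : -⟪φ u, y⟫ = (a + ⟪u, b⟫) + -⟪ψ u, y⟫ := by
      rw [hadef, hbdef, hψ, inner_neg_right, ContinuousLinearMap.adjoint_inner_right]
      simp only [inner_sub_left, inner_add_left, map_sub]
      ring
    rw [hinner, AddChar.map_add_eq_mul, Circle.smul_def, Circle.coe_mul, sub_zero, smul_eq_mul]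
    ring
  rw [hfac, lintegral_enorm_fourier_character_mul]
  set M : ℝ := C₁ * R ^ 2 * (1 + ‖y‖) with hM
  have hR2 : 1 ≤ R ^ 2 := one_le_pow₀ hR
  have hCR : 1 ≤ C₁ * R := by nlinarith
  have hCR2 : 1 ≤ C₁ * R ^ 2 := by nlinarith
  have hM1 : 1 ≤ M := by nlinarith [norm_nonneg y]
  refine (H G (fun u => ⟪ψ u, y⟫) {u | 1 < ‖u‖} 0 z R (A * R ^ l) 1 M M hR0 (by positivity)
    zero_le_one hM1 (by linarith) hUo hG (fun u hu => hball u (hGs hu)) hGs ?_ (by simp) ?_ ?_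
    ?_).trans (ENNReal.ofReal_le_ofReal ?_)
  · intro u hu
    exact ((hψs u hu).inner ℝ contDiffAt_const).contDiffWithinAt
  · intro k hk u
    refine (hGA k hk u).trans ?_
    rw [mul_assoc]
    refine le_mul_of_one_le_right hA ?_
    rw [← div_eq_mul_inv, one_le_div (by positivity)]
    exact pow_le_pow_right₀ hR hk
  · intro u hu i hi hil
    have h1 : ‖iteratedFDeriv ℝ i (fun u => ⟪ψ u, y⟫) u‖ ≤ ‖y‖ * ‖iteratedFDeriv ℝ i ψ u‖ := by
      have h2 := (innerSL ℝ y).norm_iteratedFDeriv_comp_left (f := ψ) (x := u) (n := i)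
        (N := (l : WithTop ℕ∞)) (hψs u (hball u (hGs hu))) (by exact_mod_cast hil)
      rw [innerSL_apply_norm] at h2
      have h3 : (fun u => ⟪ψ u, y⟫) = (innerSL ℝ y) ∘ ψ := by
        ext u
        simp [real_inner_comm]
      rwa [h3]
    have h4 := norm_iteratedFDeriv_sub_affine_le hn hR (by linarith) (C₁ := C₁)
      (fun v hv => hφ v (hball v hv).le) (fun k hk hk' v hv => hb k hk hk' v (hball v hv).le)
      (hGs hu) hi (hil.trans hln)
    have h5 : M / R = C₁ * R * (1 + ‖y‖) := by
      rw [hM]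
      field_simp
    have h6 : 1 ≤ M / R := by
      rw [h5]
      nlinarith [norm_nonneg y]
    calc _ ≤ ‖y‖ * ‖iteratedFDeriv ℝ i ψ u‖ := h1
      _ ≤ (1 + ‖y‖) * (C₁ * R) := by
        gcongr
        linarith
      _ = M / R := by rw [h5, mul_comm]
      _ ≤ (M / R) ^ i := le_self_pow₀ h6 (by omega)
  · intro u _
    rw [sub_zero, Circle.norm_coe]
  · rw [div_self (by positivity), hM, Real.mul_rpow (by positivity) (by positivity)]
    apply le_of_eq
    ring

/-! ### A bound uniform in the position of the window -/

/-- A multilinear map is controlled by its values on the basis vectors; for iterated derivatives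
these are the partial derivatives. -/
theorem norm_le_sum_norm_apply_single {k : ℕ} {F : Type*} [NormedAddCommGroup F] [NormedSpace ℝ F]
    (T : ContinuousMultilinearMap ℝ (fun _ : Fin k => E d) F) :
    ‖T‖ ≤ ∑ I : Fin k → Fin d, ‖T fun j => EuclideanSpace.single (I j) (1 : ℝ)‖ := by
  refine T.opNorm_le_bound (by positivity) fun m => ?_
  have hm : m = fun j => ∑ i, (m j i) • EuclideanSpace.single i (1 : ℝ) := by
    ext1 j
    conv_lhs => rw [← (EuclideanSpace.basisFun (Fin d) ℝ).sum_repr (m j)]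
    simp
  have hT : T m = ∑ I : Fin k → Fin d,
      (∏ j, m j (I j)) • T fun j => EuclideanSpace.single (I j) (1 : ℝ) := by
    conv_lhs => rw [hm]
    rw [ContinuousMultilinearMap.map_sum]
    refine Finset.sum_congr rfl fun I _ => ?_
    rw [ContinuousMultilinearMap.map_smul_univ]
  rw [hT, Finset.sum_mul]
  refine (norm_sum_le _ _).trans (Finset.sum_le_sum fun I _ => ?_)
  rw [norm_smul, mul_comm, norm_prod]
  gcongr with j
  exact PiLp.norm_apply_le (m j) (I j)

/-- Constants depending on the order `k ≤ n` of a derivative can be replaced by a single one. -/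
theorem exists_forall_le_of_forall_exists {n : ℕ} {p : ℕ → Prop} {α : Type*} {f b : ℕ → α → ℝ}
    {s : Set α} (hb : ∀ k, ∀ u ∈ s, 0 ≤ b k u)
    (h : ∀ k ≤ n, p k → ∃ C : ℝ, ∀ u ∈ s, f k u ≤ C * b k u) :
    ∃ C : ℝ, 1 ≤ C ∧ ∀ k ≤ n, p k → ∀ u ∈ s, f k u ≤ C * b k u := by
  have h1 : ∀ k : ℕ, ∃ C : ℝ, 0 ≤ C ∧ (k ≤ n → p k → ∀ u ∈ s, f k u ≤ C * b k u) := by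
    intro k
    by_cases hk : k ≤ n ∧ p k
    · obtain ⟨C, hC⟩ := h k hk.1 hk.2
      refine ⟨max C 0, le_max_right _ _, fun _ _ u hu => (hC u hu).trans ?_⟩
      exact mul_le_mul_of_nonneg_right (le_max_left _ _) (hb k u hu)
    · exact ⟨0, le_rfl, fun h1 h2 => absurd ⟨h1, h2⟩ hk⟩
  choose C hC0 hC using h1
  refine ⟨1 + ∑ k ∈ Finset.range (n + 1), C k, ?_, fun k hk hp u hu => (hC k hk hp u hu).trans ?_⟩
  · have := Finset.sum_nonneg (s := Finset.range (n + 1)) fun k _ => hC0 k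
    linarith
  · refine mul_le_mul_of_nonneg_right ?_ (hb k u hu)
    have := Finset.single_le_sum (f := C) (s := Finset.range (n + 1)) (fun i _ => hC0 i)
      (Finset.mem_range.2 (Nat.lt_succ_iff.2 hk))
    linarith

/-- The bounds on the derivatives in the unit ball extend to any larger ball, by compactness. -/
theorem exists_norm_iteratedFDeriv_le_rpow {l : ℕ} {φ : E d → E d} {σ : ℝ} (S : ℝ)
    (hφ : ContDiffOn ℝ l φ {0}ᶜ)
    (hnear : ∀ k ≤ l, ∃ C : ℝ, ∀ u : E d, u ≠ 0 → ‖u‖ ≤ 1 →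
      ‖iteratedFDeriv ℝ k φ u‖ ≤ C * ‖u‖ ^ (σ - k)) :
    ∃ C : ℝ, 1 ≤ C ∧ ∀ k ≤ l, ∀ u : E d, u ≠ 0 → ‖u‖ ≤ S →
      ‖iteratedFDeriv ℝ k φ u‖ ≤ C * ‖u‖ ^ (σ - k) := by
  obtain ⟨C, hC1, hC⟩ := exists_forall_le_of_forall_exists (n := l) (p := fun _ => True)
    (f := fun k u => ‖iteratedFDeriv ℝ k φ u‖) (b := fun (k : ℕ) (u : E d) => ‖u‖ ^ (σ - k))
    (s := {u : E d | u ≠ 0 ∧ ‖u‖ ≤ S}) (fun k u _ => by positivity) (fun k hk _ => by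
      obtain ⟨C, hC⟩ := hnear k hk
      -- on the compact shell `1 ≤ ‖u‖ ≤ S` the quotient of both sides is continuous
      have hK : IsCompact (Metric.closedBall (0 : E d) S ∩ {u | 1 ≤ ‖u‖}) :=
        (isCompact_closedBall 0 S).inter_right (isClosed_le continuous_const continuous_norm)
      have hcont : ContinuousOn (fun u => iteratedFDeriv ℝ k φ u) {0}ᶜ :=
        (hφ.continuousOn_iteratedFDerivWithin (by exact_mod_cast hk)
          isOpen_compl_singleton.uniqueDiffOn).congr fun u hu =>
            (iteratedFDerivWithin_of_isOpen k isOpen_compl_singleton hu).symm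
      have hsub : Metric.closedBall (0 : E d) S ∩ {u | 1 ≤ ‖u‖} ⊆ {0}ᶜ := by
        rintro u ⟨-, hu⟩ h0
        rw [Set.mem_singleton_iff] at h0
        have hu' : (1 : ℝ) ≤ ‖u‖ := hu
        rw [h0, norm_zero] at hu'
        linarith
      obtain ⟨B, hB⟩ := hK.exists_bound_of_continuousOn
        (f := fun u => (‖u‖ ^ (σ - k))⁻¹ • iteratedFDeriv ℝ k φ u) (by
          have hden : ContinuousOn (fun u : E d => ‖u‖ ^ (σ - (k : ℝ)))
              (Metric.closedBall (0 : E d) S ∩ {u | 1 ≤ ‖u‖}) :=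
            continuous_norm.continuousOn.rpow_const fun u hu =>
              Or.inl (norm_ne_zero_iff.2 (hsub hu))
          exact (hden.inv₀ fun u hu =>
            (Real.rpow_pos_of_pos (norm_pos_iff.2 (hsub hu)) _).ne').smul (hcont.mono hsub))
      refine ⟨max C B, fun u hu => ?_⟩
      have hu0 : 0 < ‖u‖ := norm_pos_iff.2 hu.1
      have hup : 0 < ‖u‖ ^ (σ - (k : ℝ)) := Real.rpow_pos_of_pos hu0 _
      rcases le_total ‖u‖ 1 with h | h
      · refine (hC u hu.1 h).trans ?_
        exact mul_le_mul_of_nonneg_right (le_max_left _ _) hup.le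
      · have h1 := hB u ⟨by simpa using hu.2, h⟩
        rw [norm_smul, norm_inv, Real.norm_of_nonneg hup.le, inv_mul_le_iff₀' hup] at h1
        refine h1.trans ?_
        exact mul_le_mul_of_nonneg_right (le_max_right _ _) hup.le)
  exact ⟨C, hC1, fun k hk u hu0 hu => hC k hk trivial u ⟨hu0, hu⟩⟩

theorem continuous_of_norm_le_rpow {φ : E d → E d} {σ C : ℝ} (hσ : 0 < σ) (hφ0 : φ 0 = 0)
    (hφ : ContinuousOn φ {0}ᶜ) (hb : ∀ u : E d, u ≠ 0 → ‖u‖ ≤ 1 → ‖φ u‖ ≤ C * ‖u‖ ^ σ) :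
    Continuous φ := by
  rw [continuous_iff_continuousAt]
  intro u
  by_cases hu : u = 0
  · subst hu
    rw [ContinuousAt, hφ0]
    refine squeeze_zero_norm' (a := fun u : E d => C * ‖u‖ ^ σ) ?_ ?_
    · filter_upwards [Metric.closedBall_mem_nhds (0 : E d) one_pos] with v hv
      by_cases hv0 : v = 0
      · rw [hv0, hφ0]
        simp [Real.zero_rpow hσ.ne']
      · exact hb v hv0 (by simpa using hv)
    · have h1 : Tendsto (fun u : E d => C * ‖u‖ ^ σ) (𝓝 0) (𝓝 (C * ‖(0 : E d)‖ ^ σ)) :=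
        ((continuous_norm.continuousAt).rpow_const (Or.inr hσ.le)).const_mul C
      simpa [Real.zero_rpow hσ.ne'] using h1
  · exact hφ.continuousAt (isOpen_compl_singleton.mem_nhds hu)

/-- The bound on `‖𝓕 (T_z g · e^{-2πi⟪φ, y⟫})‖_{L¹}`, uniform in the translation `z`. -/
theorem exists_lintegral_fourier_translate_le {l : ℕ} (hl : l = d / 2 + 1) {φ : E d → E d}
    {σ : ℝ} (hσ : 0 < σ) (hφ0 : φ 0 = 0) (hφc : Continuous φ) (hφ : ContDiffOn ℝ l φ {0}ᶜ)
    (hφ' : ∀ u : E d, 1 ≤ ‖u‖ → ContDiffAt ℝ ((2 * l : ℕ) : WithTop ℕ∞) φ u)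
    (hnear : ∀ k ≤ l, ∃ C : ℝ, ∀ u : E d, u ≠ 0 → ‖u‖ ≤ 1 →
      ‖iteratedFDeriv ℝ k φ u‖ ≤ C * ‖u‖ ^ (σ - k))
    (hfar : ∀ k, 2 ≤ k → k ≤ 2 * l → ∃ C : ℝ, ∀ u : E d, 1 ≤ ‖u‖ → ‖iteratedFDeriv ℝ k φ u‖ ≤ C)
    {g : E d → ℂ} (hg : ContDiff ℝ l g) (hgc : HasCompactSupport g) :
    ∃ C : ℝ, 0 < C ∧ ∀ z y : E d,
      ∫⁻ ξ, ‖𝓕 (fun u => g (u - z) * (𝐞 (-⟪φ u, y⟫) : ℂ)) ξ‖ₑ ≤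
        ENNReal.ofReal (C * (1 + ‖y‖) ^ ((d : ℝ) / 2)) := by
  rcases Nat.eq_zero_or_pos d with rfl | hd
  · -- in dimension `0` there is a single pair `(z, y)`
    have hfin : ∫⁻ ξ, ‖𝓕 (fun u => g (u - 0) * (𝐞 (-⟪φ u, (0 : E 0)⟫) : ℂ)) ξ‖ₑ ≠ ⊤ :=
      (Integrable.of_finite (μ := volume)
        (f := 𝓕 (fun u => g (u - 0) * (𝐞 (-⟪φ u, (0 : E 0)⟫) : ℂ)))).2.ne
    refine ⟨(∫⁻ ξ, ‖𝓕 (fun u => g (u - 0) * (𝐞 (-⟪φ u, (0 : E 0)⟫) : ℂ)) ξ‖ₑ).toReal + 1,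
      by positivity, fun z y => ?_⟩
    obtain rfl : z = 0 := Subsingleton.elim _ _
    obtain rfl : y = 0 := Subsingleton.elim _ _
    rw [norm_zero, add_zero, Real.one_rpow, mul_one]
    refine (ENNReal.le_ofReal_iff_toReal_le hfin (by positivity)).2 (by linarith)
  have hdl : d < 2 * l := by omega
  obtain ⟨A, hA1, hA⟩ := exists_forall_le_of_forall_exists (n := l) (p := fun _ => True)
    (f := fun k u => ‖iteratedFDeriv ℝ k g u‖) (b := fun _ _ => 1) (s := Set.univ)
    (fun _ _ _ => zero_le_one) (fun k hk _ => by
      obtain ⟨c, hc⟩ := (hgc.iteratedFDeriv (𝕜 := ℝ) k).exists_bound_of_continuous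
        (hg.continuous_iteratedFDeriv (by exact_mod_cast hk))
      exact ⟨c, fun u _ => by rw [mul_one]; exact hc u⟩)
  obtain ⟨R, hR1, hR⟩ : ∃ R : ℝ, 1 ≤ R ∧ tsupport g ⊆ Metric.closedBall 0 R := by
    obtain ⟨R, hR⟩ := hgc.isCompact.isBounded.subset_closedBall 0
    exact ⟨max R 1, le_max_right _ _,
      hR.trans (Metric.closedBall_subset_closedBall (le_max_left _ _))⟩
  obtain ⟨C₁, hC₁, hb₁⟩ := exists_norm_iteratedFDeriv_le_rpow (4 * R + 2) hφ hnear
  obtain ⟨C₂, hC₂, hb₂⟩ := exists_forall_le_of_forall_exists (n := 2 * l) (p := fun k => 2 ≤ k)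
    (f := fun k u => ‖iteratedFDeriv ℝ k φ u‖) (b := fun _ _ => 1) (s := {u : E d | 1 ≤ ‖u‖})
    (fun _ _ _ => zero_le_one) (fun k hk hk2 => by
      obtain ⟨c, hc⟩ := hfar k hk2 hk
      exact ⟨c, fun u hu => by rw [mul_one]; exact hc u hu⟩)
  obtain ⟨D₁, hD₁, H₁⟩ := exists_lintegral_fourier_near_le hd hl hσ hC₁
    (by linarith : (1 : ℝ) ≤ 4 * R + 2) hφ0 hφc hφ hb₁
  obtain ⟨D₂, hD₂, H₂⟩ := exists_lintegral_fourier_far_le (d := d) (l := l) (n := 2 * l) hdl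
    (by omega) (by omega) hR1 hC₂ hφ'
    (fun k hk hk' u hu => by simpa using hb₂ k hk' hk u hu)
  refine ⟨(D₁ + D₂) * A, by positivity, fun z y => ?_⟩
  have hgz : ContDiff ℝ l (fun u => g (u - z)) := hg.comp (contDiff_id.sub contDiff_const)
  have hgA : ∀ k ≤ l, ∀ u, ‖iteratedFDeriv ℝ k (fun u => g (u - z)) u‖ ≤ A := by
    intro k hk u
    rw [iteratedFDeriv_comp_sub]
    simpa using hA k hk trivial (u - z) (Set.mem_univ _)
  have hgs : tsupport (fun u => g (u - z)) ⊆ Metric.closedBall z R := by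
    intro u hu
    have h1 := hR (tsupport_comp_subset_preimage g (f := fun u => u - z)
      (continuous_id.sub continuous_const) hu)
    simpa [dist_eq_norm] using h1
  rcases le_or_gt ‖z‖ (R + 1) with hz | hz
  · refine (H₁ _ A y hgz hgA (hgs.trans ?_)).trans (ENNReal.ofReal_le_ofReal ?_)
    · intro u hu
      have h1 : ‖u - z‖ ≤ R := by simpa [dist_eq_norm] using hu
      have h2 := norm_add_le (u - z) z
      rw [sub_add_cancel] at h2
      simp only [Metric.mem_closedBall, dist_zero_right]
      linarith
    · gcongr
      linarith
  · refine (H₂ _ A z y hz hgz hgA hgs).trans (ENNReal.ofReal_le_ofReal ?_)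
    gcongr
    linarith

/-! ### Superposition of the localized pieces -/

/-- The normalization of the window. Its square is integrable, since the integral would otherwise
be `0` and not `1`. -/
theorem lintegral_enorm_sq_translate {g : E d → ℂ} (hg : IsWindow g) (u : E d) :
    ∫⁻ z, ‖g (u - z)‖ₑ ^ 2 = 1 := by
  rw [lintegral_sub_left_eq_self (fun z => ‖g z‖ₑ ^ 2) u]
  have hi : Integrable (fun t => ‖g t‖ ^ 2) := by
    by_contra h
    have := hg.normalized
    rw [integral_undef h] at this
    exact zero_ne_one this
  have h1 := ofReal_integral_eq_lintegral_ofReal hi (ae_of_all _ fun t => by positivity)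
  rw [hg.normalized, ENNReal.ofReal_one] at h1
  rw [h1]
  congr with t
  rw [ENNReal.ofReal_pow (norm_nonneg _), ofReal_norm]

theorem integrable_mul_translate {Φ g : E d → ℂ} (hΦ : LocallyIntegrable Φ volume)
    (hg : IsWindow g) (z : E d) : Integrable (fun u => Φ u * g (u - z)) := by
  have hc : HasCompactSupport (fun u => g (u - z)) :=
    hg.compactSupport.comp_homeomorph (Homeomorph.subRight z)
  exact hΦ.integrable_smul_right_of_hasCompactSupport
    (hg.smooth.continuous.comp (continuous_id.sub continuous_const)) hc

theorem aemeasurable_enorm_mul_translate_sq {Φ g : E d → ℂ} (hΦ : LocallyIntegrable Φ volume)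
    (hg : IsWindow g) :
    AEMeasurable (fun p : E d × E d => ‖Φ p.1‖ₑ * ‖g (p.1 - p.2)‖ₑ ^ 2) (volume.prod volume) := by
  have hgc := hg.smooth.continuous
  refine AEMeasurable.mul hΦ.aestronglyMeasurable.comp_fst.enorm (Measurable.aemeasurable ?_)
  exact ((hgc.measurable.comp (measurable_fst.sub measurable_snd)).enorm).pow_const 2

theorem lintegral_lintegral_enorm_mul_translate_sq {Φ g : E d → ℂ} (hg : IsWindow g) :
    ∫⁻ u, ∫⁻ z, ‖Φ u‖ₑ * ‖g (u - z)‖ₑ ^ 2 = ∫⁻ u, ‖Φ u‖ₑ := by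
  congr with u
  rw [lintegral_const_mul' _ _ enorm_ne_top, lintegral_enorm_sq_translate hg, mul_one]

/-- The inclusion `M¹ ⊆ L¹`, which makes the integral defining the kernel converge absolutely. -/
theorem MemM1.integrable {Φ : E d → ℂ} (hΦ : MemM1 Φ) : Integrable Φ := by
  obtain ⟨hloc, g, hg, hfin⟩ := hΦ
  refine ⟨hloc.aestronglyMeasurable, ?_⟩
  have hgi : Integrable g := hg.smooth.continuous.integrable_of_hasCompactSupport hg.compactSupport
  calc ∫⁻ u, ‖Φ u‖ₑ = ∫⁻ u, ∫⁻ z, ‖Φ u‖ₑ * ‖g (u - z)‖ₑ ^ 2 :=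
        (lintegral_lintegral_enorm_mul_translate_sq hg).symm
    _ = ∫⁻ z, ∫⁻ u, ‖Φ u‖ₑ * ‖g (u - z)‖ₑ ^ 2 :=
        lintegral_lintegral_swap (aemeasurable_enorm_mul_translate_sq hloc hg)
    _ ≤ ∫⁻ z, (∫⁻ ω, ‖stft g Φ z ω‖ₑ) * ∫⁻ u, ‖g u‖ₑ := by
        refine lintegral_mono fun z => ?_
        rw [← lintegral_sub_right_eq_self (fun u => ‖g u‖ₑ) z, ← lintegral_const_mul'' _
          ((hgi.comp_sub_right z).aestronglyMeasurable.enorm)]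
        refine lintegral_mono_ae ?_
        filter_upwards [ae_enorm_le_lintegral_fourier (integrable_mul_translate hloc hg z)]
          with u hu
        rw [pow_two, ← mul_assoc, ← enorm_mul]
        exact mul_le_mul_left hu _
    _ = (∫⁻ z, ∫⁻ ω, ‖stft g Φ z ω‖ₑ) * ∫⁻ u, ‖g u‖ₑ := lintegral_mul_const' _ _ hgi.2.ne
    _ < ⊤ := ENNReal.mul_lt_top hfin hgi.2

/-- `𝓕⁻ (Φ m)` as a superposition of localized pieces, by Fubini and `∫ |g(u - z)|² dz = 1`. -/
theorem fourierInv_mul_eq_integral {Φ g m : E d → ℂ} (hΦ : Integrable Φ) (hg : IsWindow g)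
    (hm : Continuous m) (hm1 : ∀ u, ‖m u‖ = 1) (x : E d) :
    𝓕⁻ (fun u => Φ u * m u) x =
      ∫ z, 𝓕⁻ (fun u => (Φ u * g (u - z)) * (starRingEnd ℂ (g (u - z)) * m u)) x := by
  have hgc := hg.smooth.continuous
  have hnorm : ∀ u z, ‖𝐞 ⟪u, x⟫ •
      ((Φ u * g (u - z)) * (starRingEnd ℂ (g (u - z)) * m u))‖ₑ = ‖Φ u‖ₑ * ‖g (u - z)‖ₑ ^ 2 := by
    intro u z
    have h1 : ‖m u‖ₑ = 1 := by rw [← ofReal_norm, hm1, ENNReal.ofReal_one]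
    have h2 : ‖starRingEnd ℂ (g (u - z))‖ₑ = ‖g (u - z)‖ₑ := by
      rw [← ofReal_norm, RCLike.norm_conj, ofReal_norm]
    rw [← ofReal_norm, Circle.norm_smul, ofReal_norm, enorm_mul, enorm_mul, enorm_mul, h1, h2]
    ring
  have hint : Integrable (fun p : E d × E d => 𝐞 ⟪p.1, x⟫ •
      ((Φ p.1 * g (p.1 - p.2)) * (starRingEnd ℂ (g (p.1 - p.2)) * m p.1)))
      (volume.prod volume) := by
    constructor
    · have h1 : AEStronglyMeasurable (fun p : E d × E d => Φ p.1) (volume.prod volume) :=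
        hΦ.1.comp_fst
      have h2 : Continuous (fun p : E d × E d => g (p.1 - p.2)) := by fun_prop
      have h3 : Continuous (fun p : E d × E d => starRingEnd ℂ (g (p.1 - p.2)) * m p.1) :=
        (Complex.continuous_conj.comp h2).mul (hm.comp continuous_fst)
      have h4 : Continuous (fun p : E d × E d => (𝐞 ⟪p.1, x⟫ : ℂ)) := by fun_prop
      exact h4.aestronglyMeasurable.mul
        ((h1.mul h2.aestronglyMeasurable).mul h3.aestronglyMeasurable)
    · rw [hasFiniteIntegral_iff_enorm]
      simp_rw [hnorm]
      rw [lintegral_prod _ (aemeasurable_enorm_mul_translate_sq hΦ.locallyIntegrable hg),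
        lintegral_lintegral_enorm_mul_translate_sq hg]
      exact hΦ.2
  simp only [Real.fourierInv_eq]
  rw [← integral_integral_swap (f := fun u z => 𝐞 ⟪u, x⟫ •
      ((Φ u * g (u - z)) * (starRingEnd ℂ (g (u - z)) * m u))) hint]
  congr with u
  have h1 : ∀ z, 𝐞 ⟪u, x⟫ • ((Φ u * g (u - z)) * (starRingEnd ℂ (g (u - z)) * m u)) =
      (𝐞 ⟪u, x⟫ • (Φ u * m u)) * ((‖g (u - z)‖ ^ 2 : ℝ) : ℂ) := by
    intro z
    rw [Complex.ofReal_pow, ← Complex.mul_conj', Circle.smul_def, Circle.smul_def, smul_eq_mul,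
      smul_eq_mul]
    ring
  have h2 : ∫ z, ‖g (u - z)‖ ^ 2 = 1 := by
    rw [integral_sub_left_eq_self (fun z => ‖g z‖ ^ 2) volume u]
    exact hg.normalized
  simp_rw [h1]
  rw [integral_const_mul, integral_complex_ofReal, h2]
  simp

theorem lintegral_enorm_fourierInv_mul_le_of_window {Φ g m : E d → ℂ} (hΦ : Integrable Φ)
    (hg : IsWindow g) (hm : Continuous m) (hm1 : ∀ u, ‖m u‖ = 1) {B : ℝ≥0∞} (hB : B ≠ ⊤)
    (hmB : ∀ z, ∫⁻ ξ, ‖𝓕 (fun u => starRingEnd ℂ (g (u - z)) * m u) ξ‖ₑ ≤ B) :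
    ∫⁻ x, ‖𝓕⁻ (fun u => Φ u * m u) x‖ₑ ≤ (∫⁻ z, ∫⁻ ω, ‖stft g Φ z ω‖ₑ) * B := by
  have hgc := hg.smooth.continuous
  have hmeas : AEMeasurable (fun p : E d × E d =>
      ‖𝓕⁻ (fun u => (Φ u * g (u - p.2)) * (starRingEnd ℂ (g (u - p.2)) * m u)) p.1‖ₑ)
      (volume.prod volume) := by
    have h1 : AEStronglyMeasurable (fun p : (E d × E d) × E d => 𝐞 ⟪p.2, p.1.1⟫ •
        ((Φ p.2 * g (p.2 - p.1.2)) * (starRingEnd ℂ (g (p.2 - p.1.2)) * m p.2)))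
        ((volume.prod volume).prod volume) := by
      have h1 : AEStronglyMeasurable (fun p : (E d × E d) × E d => Φ p.2)
        ((volume.prod volume).prod volume) := hΦ.1.comp_snd
      have h2 : Continuous (fun p : (E d × E d) × E d => g (p.2 - p.1.2)) := by fun_prop
      have h3 : Continuous (fun p : (E d × E d) × E d =>
          starRingEnd ℂ (g (p.2 - p.1.2)) * m p.2) :=
        (Complex.continuous_conj.comp h2).mul (hm.comp continuous_snd)
      have h4 : Continuous (fun p : (E d × E d) × E d => (𝐞 ⟪p.2, p.1.1⟫ : ℂ)) := by fun_prop
      exact h4.aestronglyMeasurable.mul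
        ((h1.mul h2.aestronglyMeasurable).mul h3.aestronglyMeasurable)
    have h2 := h1.integral_prod_right'
    simp only [Real.fourierInv_eq]
    exact h2.enorm
  calc ∫⁻ x, ‖𝓕⁻ (fun u => Φ u * m u) x‖ₑ
      ≤ ∫⁻ x, ∫⁻ z,
          ‖𝓕⁻ (fun u => (Φ u * g (u - z)) * (starRingEnd ℂ (g (u - z)) * m u)) x‖ₑ := by
        refine lintegral_mono fun x => ?_
        rw [fourierInv_mul_eq_integral hΦ hg hm hm1]
        exact enorm_integral_le_lintegral_enorm _
    _ = ∫⁻ z, ∫⁻ x,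
          ‖𝓕⁻ (fun u => (Φ u * g (u - z)) * (starRingEnd ℂ (g (u - z)) * m u)) x‖ₑ :=
        lintegral_lintegral_swap hmeas
    _ ≤ ∫⁻ z, (∫⁻ ω, ‖stft g Φ z ω‖ₑ) * B := by
        refine lintegral_mono fun z => ?_
        have hc : Continuous (fun u => starRingEnd ℂ (g (u - z)) * m u) :=
          (Complex.continuous_conj.comp (hgc.comp (continuous_id.sub continuous_const))).mul hm
        have hs : HasCompactSupport (fun u => starRingEnd ℂ (g (u - z)) * m u) :=
          ((hg.compactSupport.comp_homeomorph (Homeomorph.subRight z)).comp_left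
            (g := starRingEnd ℂ) (map_zero _)).mul_right
        refine (lintegral_enorm_fourierInv_mul_le
          (integrable_mul_translate hΦ.locallyIntegrable hg z)
          (hc.integrable_of_hasCompactSupport hs) hc).trans ?_
        exact mul_le_mul_right (hmB z) _
    _ = _ := lintegral_mul_const' _ _ hB

theorem integrand_eq (Φ : E d → ℂ) (β : ℝ → ℝ) (x y u : E d) :
    integrand Φ β x y u = 𝐞 ⟪u, x⟫ • (Φ u * (𝐞 (-⟪phase β u, y⟫) : ℂ)) := by
  rw [integrand, Circle.smul_def, smul_eq_mul, mul_left_comm, ← Circle.coe_mul,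
    ← AddChar.map_add_eq_mul, Real.fourierChar_apply]
  congr 2
  push_cast
  ring

theorem kernel_eq_fourierInv (Φ : E d → ℂ) (β : ℝ → ℝ) (x y : E d) :
    kernel Φ β x y = 𝓕⁻ (fun u => Φ u * (𝐞 (-⟪phase β u, y⟫) : ℂ)) x := by
  rw [kernel, Real.fourierInv_eq]
  simp only [integrand_eq]

end Euclidean

end FIOKernel


theorem theorem3p2 (d l : ℕ) (hl : l = d / 2 + 1)
    (Φ : FIOKernel.E d → ℂ) (hΦ : FIOKernel.MemM1 Φ)
    (β : ℝ → ℝ) (γ : ℝ) (hγ : γ ∈ Set.Ioc (-1 : ℝ) 1)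
    -- the derivatives in the two hypotheses below exist (and are continuous)
    (hsmooth : ∀ u : FIOKernel.E d, u ≠ 0 →
      ContDiffAt ℝ (l : WithTop ℕ∞) (FIOKernel.phase β) u)
    (hsmooth' : ∀ u : FIOKernel.E d, 1 ≤ ‖u‖ →
      ContDiffAt ℝ ((2 * l : ℕ) : WithTop ℕ∞) (FIOKernel.phase β) u)
    (hnear : ∀ k : ℕ, k ≤ l → ∀ I : Fin k → Fin d, ∃ C : ℝ, 0 < C ∧
      ∀ u : FIOKernel.E d, u ≠ 0 → ‖u‖ ≤ 1 →
        ‖FIOKernel.partialDeriv I (FIOKernel.phase β) u‖ ≤ C * ‖u‖ ^ (γ + 1 - (k : ℝ)))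
    (hfar : ∀ k : ℕ, 2 ≤ k → k ≤ 2 * l → ∀ I : Fin k → Fin d, ∃ C' : ℝ, 0 < C' ∧
      ∀ u : FIOKernel.E d, 1 ≤ ‖u‖ →
        ‖FIOKernel.partialDeriv I (FIOKernel.phase β) u‖ ≤ C') :
    (∀ x y : FIOKernel.E d,
      MeasureTheory.Integrable (fun u : FIOKernel.E d => FIOKernel.integrand Φ β x y u)) ∧
    ∃ C : ℝ, 0 < C ∧ ∀ y : FIOKernel.E d,
      MeasureTheory.Integrable (fun x : FIOKernel.E d => FIOKernel.kernel Φ β x y) ∧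
      ∫ x : FIOKernel.E d, ‖FIOKernel.kernel Φ β x y‖ ≤
        C * (1 + ‖y‖) ^ ((d : ℝ) / (γ + 1)) := by
  have hσ : 0 < γ + 1 := by linarith [hγ.1]
  have hφ0 : FIOKernel.phase β (0 : FIOKernel.E d) = 0 := by simp [FIOKernel.phase]
  have hφ : ContDiffOn ℝ l (FIOKernel.phase (d := d) β) {0}ᶜ := fun u hu =>
    (hsmooth u hu).contDiffWithinAt
  -- bounds on partial derivatives are bounds on the full derivatives
  have hnear' : ∀ k ≤ l, ∃ C : ℝ, ∀ u : FIOKernel.E d, u ≠ 0 → ‖u‖ ≤ 1 →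
      ‖iteratedFDeriv ℝ k (FIOKernel.phase β) u‖ ≤ C * ‖u‖ ^ (γ + 1 - k) := by
    intro k hk
    choose C hC0 hC using hnear k hk
    refine ⟨∑ I, C I, fun u hu0 hu => ?_⟩
    rw [Finset.sum_mul]
    exact (FIOKernel.norm_le_sum_norm_apply_single _).trans
      (Finset.sum_le_sum fun I _ => hC I u hu0 hu)
  have hfar' : ∀ k, 2 ≤ k → k ≤ 2 * l → ∃ C : ℝ, ∀ u : FIOKernel.E d, 1 ≤ ‖u‖ →
      ‖iteratedFDeriv ℝ k (FIOKernel.phase β) u‖ ≤ C := by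
    intro k hk2 hk
    choose C hC0 hC using hfar k hk2 hk
    exact ⟨∑ I, C I, fun u hu => (FIOKernel.norm_le_sum_norm_apply_single _).trans
      (Finset.sum_le_sum fun I _ => hC I u hu)⟩
  have hφc : Continuous (FIOKernel.phase (d := d) β) := by
    obtain ⟨C, hC⟩ := hnear' 0 (Nat.zero_le _)
    exact FIOKernel.continuous_of_norm_le_rpow hσ hφ0 hφ.continuousOn fun u hu0 hu => by
      simpa using hC u hu0 hu
  have hmc : ∀ y : FIOKernel.E d, Continuous
      (fun u => (Real.fourierChar (-inner ℝ (FIOKernel.phase β u) y) : ℂ)) := fun y => by fun_prop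
  have hΦi : Integrable Φ := hΦ.integrable
  have hΦm : ∀ y : FIOKernel.E d, Integrable
      (fun u => Φ u * (Real.fourierChar (-inner ℝ (FIOKernel.phase β u) y) : ℂ)) := fun y =>
    hΦi.mul_bdd (c := 1) (hmc y).aestronglyMeasurable (ae_of_all _ fun u => by
      rw [Circle.norm_coe])
  refine ⟨fun x y => ?_, ?_⟩
  · simp only [FIOKernel.integrand_eq]
    have h1 := (Real.fourierIntegral_convergent_iff (-x)).2 (hΦm y)
    simpa only [inner_neg_right, neg_neg] using h1
  obtain ⟨-, g, hg, hfin⟩ := hΦ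
  obtain ⟨C, hC, H⟩ := FIOKernel.exists_lintegral_fourier_translate_le hl hσ hφ0 hφc hφ hsmooth'
    hnear' hfar' (g := fun u => starRingEnd ℂ (g u))
    (Complex.conjCLE.contDiff.comp (hg.smooth.of_le (by exact_mod_cast le_top)))
    (hg.compactSupport.comp_left (g := starRingEnd ℂ) (map_zero _))
  set N := ∫⁻ z, ∫⁻ ω, ‖FIOKernel.stft g Φ z ω‖ₑ with hN
  refine ⟨N.toReal * C + 1, by positivity, fun y => ?_⟩
  have hbound : ∫⁻ x, ‖FIOKernel.kernel Φ β x y‖ₑ ≤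
      N * ENNReal.ofReal (C * (1 + ‖y‖) ^ ((d : ℝ) / 2)) := by
    simp only [FIOKernel.kernel_eq_fourierInv]
    exact FIOKernel.lintegral_enorm_fourierInv_mul_le_of_window hΦi hg (hmc y)
      (fun u => Circle.norm_coe _) ENNReal.ofReal_ne_top fun z => H z y
  have hKi : Integrable (fun x => FIOKernel.kernel Φ β x y) := by
    refine ⟨?_, hbound.trans_lt (ENNReal.mul_lt_top hfin ENNReal.ofReal_lt_top)⟩
    simp only [FIOKernel.kernel_eq_fourierInv]
    exact (FIOKernel.continuous_fourierInv (hΦm y)).aestronglyMeasurable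
  refine ⟨hKi, ?_⟩
  rw [integral_norm_eq_lintegral_enorm hKi.1]
  have h1 := ENNReal.toReal_mono (ENNReal.mul_lt_top hfin ENNReal.ofReal_lt_top).ne hbound
  rw [ENNReal.toReal_mul, ENNReal.toReal_ofReal (by positivity)] at h1
  have hexp : (1 + ‖y‖) ^ ((d : ℝ) / 2) ≤ (1 + ‖y‖) ^ ((d : ℝ) / (γ + 1)) := by
    refine Real.rpow_le_rpow_of_exponent_le (by linarith [norm_nonneg y]) ?_
    exact div_le_div_of_nonneg_left (by positivity) hσ (by linarith [hγ.2])
  calc _ ≤ N.toReal * (C * (1 + ‖y‖) ^ ((d : ℝ) / 2)) := h1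
    _ ≤ N.toReal * (C * (1 + ‖y‖) ^ ((d : ℝ) / (γ + 1))) := by gcongr
    _ = N.toReal * C * (1 + ‖y‖) ^ ((d : ℝ) / (γ + 1)) := by ring
    _ ≤ _ := by
        gcongr
        linarith
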